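/- All graphs are finite, simple and undirected; connected graphs are non-empty. For a set $X$, an $X$-labeled graph is a graph $G$ together with a function $\mathrm{lab}_G\colon V(G)\to 2^X$; deleting vertices keeps the labels of the others. A minor model of $H$ in $G$ assigns to each $v\in V(H)$ a branch set $\varphi(v)\subseteq V(G)$ such that each $G[\varphi(v)]$ is non-empty and connected, distinct vertices have disjoint branch sets, and for every edge $\{u,v\}$ of $H$ some edge of $G$ joins $\varphi(u)$ to $\varphi(v)$. For $X$-labeled $H$ and $G$, it is a labeled minor model if moreover $\mathrm{lab}_H(v)\subseteq\bigcup_{u\in\varphi(v)}\mathrm{lab}_G(u)$ for all $v\in V(H)$. A graph leaves (contains) a $\mathcal Q$-minor if some $H\in\mathcal Q$ has a labeled minor model in it. A set $\mathcal Q$ of $X$-labeled graphs is $s$-saturated if for every $L\subseteq X$ with $|L|=s$ it contains a single-vertex graph whose vertex has label set exactly $L$. A graph is $\mathcal F$-minor-free if no $H\in\mathcal F$ has a minor model in it; an optimal solution to $\mathcal F$-Minor Deletion on $G$ is a minimum-size set $Y\subseteq V(G)$ such that $G\setminus Y$ is $\mathcal F$-minor-free (labels are ignored). An $\mathcal F$-elimination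 forest of a connected graph $G$ is a finite rooted tree $T$ with pairwise disjoint bags $\chi(t)\subseteq V(G)$, $t\in V(T)$, covering $V(G)$, such that $|\chi(t)|=1$ for every non-leaf $t$; the two ends of each edge of $G$ lie in a common leaf bag or in the bags of two nodes one of which is an ancestor of the other; and for every leaf $t$ the graph $G[\chi(t)]$ is $\mathcal F$-minor-free and is connected or empty. For general $G$, an $\mathcal F$-elimination forest is a disjoint union of $\mathcal F$-elimination forests of its connected components. The elimination distance $\mathrm{ed}_{\mathcal F}(G)$ is the minimum depth, in number of edges, of an $\mathcal F$-elimination forest of $G$ (and $0$ for the empty graph). **Main Lemma.** For every non-empty finite set $\mathcal F$ of connected graphs there is a function $f\colon\mathbb N\to\mathbb N$ such that the following holds. Let $X$ be a set, let $\mathcal Q$ be a $\bigl(\min_{H\in\mathcal F}|V(H)|\bigr)$-saturated set of connected $X$-labeled graphs, each with at most $\max_{H\in\mathcal F}|E(H)|+1$ vertices, and let $C$ be an $X$-labeled graph. If for every optimal solution $Y$ to $\mathcal F$-Minor Deletion on $C$ the graph $C\setminus Y$ contains a labeled $\mathcal Q$-minor, then there is a subset $\mathcal Q^*\subseteq\mathcal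 Q$ with $|\mathcal Q^*|\le f(\mathrm{ed}_{\mathcal F}(C))$ such that for every optimal solution $Y$ to $\mathcal F$-Minor Deletion on $C$ the graph $C\setminus Y$ contains a labeled $\mathcal Q^*$-minor. -/

import Mathlib

universe u v w z

/-- A finite simple undirected graph. -/
structure FinGraph where
  /-- the vertex set -/
  V : Type u
  [finite : Finite V]
  /-- the adjacency relation -/
  graph : SimpleGraph V

attribute [instance] FinGraph.finite

/-- An `X`-labeled graph: a finite graph with a (possibly empty) set of labels on each vertex. -/
structure LabeledGraph (X : Type v) extends FinGraph.{w} where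
  /-- the label function -/
  lab : V → Set X

/-- The subgraph of `G` induced by the vertex set `S`. -/
def FinGraph.induce (G : FinGraph.{u}) (S : Set G.V) : FinGraph.{u} where
  V := S
  graph := G.graph.induce S

/-- `G ∖ Y`: the graph obtained by deleting the vertices in `Y`. -/
def FinGraph.delete (G : FinGraph.{u}) (Y : Set G.V) : FinGraph.{u} :=
  G.induce Yᶜ

/-- `G ∖ Y` for an `X`-labeled graph; the remaining vertices keep their labels. -/
def LabeledGraph.delete {X : Type v} (G : LabeledGraph.{v, w} X) (Y : Set G.V) :
    LabeledGraph.{v, w} X where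
  toFinGraph := G.toFinGraph.delete Y
  lab := fun x => G.lab x.1

/-- `φ` is a minor model of `H` in `G`: it assigns to each vertex of `H` a branch set. -/
structure IsMinorModel (H : FinGraph.{u}) (G : FinGraph.{w}) (φ : H.V → Set G.V) : Prop where
  /-- branch sets are non-empty and connected -/
  connected : ∀ a, (G.graph.induce (φ a)).Connected
  /-- branch sets of distinct vertices are disjoint -/
  disjoint : ∀ a b, a ≠ b → Disjoint (φ a) (φ b)
  /-- every edge of `H` is realized between the branch sets of its ends -/
  adj : ∀ a b, H.graph.Adj a b → ∃ a' ∈ φ a, ∃ b' ∈ φ b, G.graph.Adj a' b'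

/-- `H` is a minor of `G`. -/
def IsMinor (H : FinGraph.{u}) (G : FinGraph.{w}) : Prop :=
  ∃ φ : H.V → Set G.V, IsMinorModel H G φ

/-- `H` is a labeled minor of `G`: some minor model has the property that each label of a vertex
of `H` occurs in the branch set of that vertex. -/
def IsLabeledMinor {X : Type v} (H : LabeledGraph.{v, u} X) (G : LabeledGraph.{v, w} X) : Prop :=
  ∃ φ : H.V → Set G.V, IsMinorModel H.toFinGraph G.toFinGraph φ ∧
    ∀ a, ∀ l ∈ H.lab a, ∃ a' ∈ φ a, l ∈ G.lab a'

/-- `G` has no minor in `F`. -/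
def IsMinorFree (F : Set FinGraph.{u}) (G : FinGraph.{w}) : Prop :=
  ∀ H ∈ F, ¬ IsMinor H G

/-- `G` contains a labeled `Q`-minor, that is, some member of `Q` as a labeled minor. -/
def HasLabeledMinor {X : Type v} (Q : Set (LabeledGraph.{v, u} X)) (G : LabeledGraph.{v, w} X) :
    Prop :=
  ∃ H ∈ Q, IsLabeledMinor H G

/-- `Y` is a solution to `F`-Minor Deletion on `G`. -/
def IsSolution (F : Set FinGraph.{u}) (G : FinGraph.{w}) (Y : Set G.V) : Prop :=
  IsMinorFree F (G.delete Y)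

/-- `Y` is a solution to `F`-Minor Deletion on `G` of minimum size. -/
def IsOptimalSolution (F : Set FinGraph.{u}) (G : FinGraph.{w}) (Y : Set G.V) : Prop :=
  IsSolution F G Y ∧ ∀ Y' : Set G.V, IsSolution F G Y' → Y.ncard ≤ Y'.ncard

/-- An `F`-elimination forest of a connected graph `G`. In a `RootedTree`, `s ≤ t` means that
`s` is an ancestor of `t` or equal to `t`, and the leaves are the maximal nodes. Bags of leaves
may be empty, which is why their connectedness is expressed by `Preconnected`. -/
structure ElimTree (F : Set FinGraph.{u}) (G : FinGraph.{w}) where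
  /-- the rooted tree -/
  T : RootedTree.{0}
  finite : Finite T
  /-- the bags -/
  bag : T → Set G.V
  cover : (⋃ t, bag t) = Set.univ
  disjoint : ∀ s t, s ≠ t → Disjoint (bag s) (bag t)
  internal : ∀ t, ¬ IsMax t → (bag t).ncard = 1
  edge : ∀ a b, G.graph.Adj a b →
    (∃ t, IsMax t ∧ a ∈ bag t ∧ b ∈ bag t) ∨
    (∃ s t, a ∈ bag s ∧ b ∈ bag t ∧ (s < t ∨ t < s))
  leaf : ∀ t, IsMax t → (G.graph.induce (bag t)).Preconnected ∧ IsMinorFree F (G.induce (bag t))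

/-- The depth, in number of edges: the depth of a node is its number of proper ancestors. -/
noncomputable def ElimTree.depth {F : Set FinGraph.{u}} {G : FinGraph.{w}} (E : ElimTree F G) : ℕ :=
  ⨆ t : E.T, (Set.Iio t).ncard

/-- An `F`-elimination forest of a graph `G`: one for each connected component of `G`. -/
def ElimForest (F : Set FinGraph.{u}) (G : FinGraph.{w}) :=
  ∀ c : G.graph.ConnectedComponent, ElimTree F (G.induce c.supp)

/-- The depth of an elimination forest is the maximum depth of its trees. -/
noncomputable def ElimForest.depth {F : Set FinGraph.{u}} {G : FinGraph.{w}} (E : ElimForest F G) :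
    ℕ :=
  ⨆ c : G.graph.ConnectedComponent, (E c).depth

/-- The elimination distance of `G` to the class of `F`-minor-free graphs: the minimum depth of an
`F`-elimination forest of `G`. (If no member of `F` is the null graph, a forest exists.) -/
noncomputable def elimDist (F : Set FinGraph.{u}) (G : FinGraph.{w}) : ℕ :=
  sInf (Set.range fun E : ElimForest F G => E.depth)

/-- `min_{H ∈ F} |V(H)|` -/
noncomputable def minVerts (F : Set FinGraph.{u}) : ℕ :=
  sInf ((fun H : FinGraph.{u} => Nat.card H.V) '' F)

/-- `max_{H ∈ F} |E(H)|` -/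
noncomputable def maxEdges (F : Set FinGraph.{u}) : ℕ :=
  sSup ((fun H : FinGraph.{u} => H.graph.edgeSet.ncard) '' F)

/-- `Q` is `s`-saturated: for each set of exactly `s` labels, `Q` contains a single-vertex graph
whose vertex has exactly these labels. -/
def IsSaturated {X : Type v} (s : ℕ) (Q : Set (LabeledGraph.{v, w} X)) : Prop :=
  ∀ L : Set X, L.encard = s → ∃ H ∈ Q, Nat.card H.V = 1 ∧ ∀ a : H.V, H.lab a = L

/-! It suffices to find a label set `T`, of size bounded in the elimination distance, such that
after every optimal deletion some member of `Q` with all labels in `T` survives (`exists_labels`).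
Such members realize boundedly many patterns, and one member per pattern is kept.

`T` comes from an exchange argument. `Good D B k T` says: a deletion set `Y` in `D` within `k` of
the optimum that leaves no controlled pattern over `T` can be exchanged for a set `Z`, no larger,
such that whatever `D` is attached to through `B`, all controlled patterns that survive `Z` with all
labels also survive `Y` with the labels of `D` cut down to `T`. For the whole graph, an optimal `Y`
that leaves no member of `Q` over `T` would give an optimal `Z` that leaves no member of `Q` at all.
Saturation enters because, after an admissible deletion, connected sets see fewer than `s` labels of
`T`.

The bound is an induction on the elimination distance (`Valid.exists_good`). A vertex `p` of a
component is either deleted or moved to the boundary (`Valid.good_of_vertex`). In an `F`-minor-free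
set the optimum is 0, and a star argument (`Scatters.exists_forced`) shows that there are few
labels, or that few labels force a vertex into every admissible deletion set; then `k` drops
(`Valid.exists_good_of_free`).

The number of components is unbounded, and `Valid.exists_good_iUnion` deals with that. A piece acts
on its surroundings only through its folio (`Pattern.MinorIn.replace`), and a minor model needs
boundedly many pieces (`Pattern.MinorIn.trim`). Representatives of all classes of pieces are chosen
in many rounds. A piece that is never chosen imitates a chosen one whose folio occurs on more chosen
pieces than a model needs, so it can be dropped (`Valid.drop_piece`). -/

namespace MinorDeletion

/-! ### Connectivity inside vertex sets -/

section Connectivity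

variable {V : Type z} {G : SimpleGraph V}

/-- `u` and `v` are joined by a walk all of whose edges lie in `S`. -/
def LinkedIn (G : SimpleGraph V) (S : Set V) : V → V → Prop :=
  Relation.ReflTransGen fun x y => G.Adj x y ∧ x ∈ S ∧ y ∈ S

/-- The set `S` is non-empty and induces a connected subgraph. -/
def ConnIn (G : SimpleGraph V) (S : Set V) : Prop :=
  S.Nonempty ∧ ∀ x ∈ S, ∀ y ∈ S, LinkedIn G S x y

lemma LinkedIn.refl (S : Set V) (x : V) : LinkedIn G S x x := Relation.ReflTransGen.refl

lemma LinkedIn.trans {S : Set V} {x y t : V} (h : LinkedIn G S x y) (h' : LinkedIn G S y t) :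
    LinkedIn G S x t := Relation.ReflTransGen.trans h h'

lemma LinkedIn.symm {S : Set V} {x y : V} (h : LinkedIn G S x y) : LinkedIn G S y x := by
  induction h with
  | refl => exact Relation.ReflTransGen.refl
  | tail _ h ih => exact (Relation.ReflTransGen.single ⟨h.1.symm, h.2.2, h.2.1⟩).trans ih

lemma LinkedIn.mono {S S' : Set V} (hS : S ⊆ S') {x y : V} (h : LinkedIn G S x y) :
    LinkedIn G S' x y :=
  Relation.ReflTransGen.mono (fun _ _ h => ⟨h.1, hS h.2.1, hS h.2.2⟩) _ _ h

lemma LinkedIn.of_adj {S : Set V} {x y : V} (h : G.Adj x y) (hx : x ∈ S) (hy : y ∈ S) :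
    LinkedIn G S x y := Relation.ReflTransGen.single ⟨h, hx, hy⟩

/-- A set without edges to the rest of `S` cannot be left by a walk in `S`. -/
lemma LinkedIn.mem_of_closed {S P : Set V} (hP : ∀ x ∈ P, ∀ y ∈ S, G.Adj x y → y ∈ P) {x y : V}
    (h : LinkedIn G S x y) (hx : x ∈ P) : y ∈ P ∧ LinkedIn G (S ∩ P) x y := by
  induction h with
  | refl => exact ⟨hx, LinkedIn.refl _ _⟩
  | tail _ h ih =>
    have := hP _ ih.1 _ h.2.2 h.1
    exact ⟨this, ih.2.trans (.of_adj h.1 ⟨h.2.1, ih.1⟩ ⟨h.2.2, this⟩)⟩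

lemma ConnIn.subset_of_closed {A S P : Set V} (hA : ConnIn G A) (hAS : A ⊆ S)
    (hP : ∀ x ∈ P, ∀ y ∈ S, G.Adj x y → y ∈ P) (hne : (A ∩ P).Nonempty) : A ⊆ P := by
  obtain ⟨x, hxA, hxP⟩ := hne
  intro y hy
  exact ((hA.2 x hxA y hy).mem_of_closed (fun a ha b hb => hP a ha b (hAS hb)) hxP).1

lemma connIn_singleton (x : V) : ConnIn G {x} := by
  refine ⟨⟨x, rfl⟩, ?_⟩
  rintro a rfl b rfl
  exact LinkedIn.refl _ _

/-- The set of vertices that are linked to `x` in `S`. -/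
def compIn (G : SimpleGraph V) (S : Set V) (x : V) : Set V := {y | y ∈ S ∧ LinkedIn G S x y}

lemma compIn_subset (S : Set V) (x : V) : compIn G S x ⊆ S := fun _ h => h.1

lemma compIn_closed {S : Set V} {x : V} :
    ∀ a ∈ compIn G S x, ∀ b ∈ S, G.Adj a b → b ∈ compIn G S x :=
  fun _ ha _ hb hab => ⟨hb, ha.2.trans (.of_adj hab ha.1 hb)⟩

lemma mem_compIn_self {S : Set V} {x : V} (hx : x ∈ S) : x ∈ compIn G S x :=
  ⟨hx, LinkedIn.refl _ _⟩

lemma connIn_compIn {S : Set V} {x : V} (hx : x ∈ S) : ConnIn G (compIn G S x) := by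
  have key : ∀ y ∈ compIn G S x, LinkedIn G (compIn G S x) x y := by
    intro y hy
    exact (hy.2.mem_of_closed compIn_closed (mem_compIn_self hx)).2.mono Set.inter_subset_right
  exact ⟨⟨x, mem_compIn_self hx⟩, fun a ha b hb => (key a ha).symm.trans (key b hb)⟩

lemma compIn_eq_of_mem {S : Set V} {x y : V} (h : y ∈ compIn G S x) :
    compIn G S y = compIn G S x := by
  ext a
  exact ⟨fun ha => ⟨ha.1, h.2.trans ha.2⟩, fun ha => ⟨ha.1, h.2.symm.trans ha.2⟩⟩

lemma disjoint_compIn {S : Set V} {x y : V} (h : compIn G S x ≠ compIn G S y) :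
    Disjoint (compIn G S x) (compIn G S y) := by
  rw [Set.disjoint_left]
  intro a hx hy
  exact h ((compIn_eq_of_mem hx).symm.trans (compIn_eq_of_mem hy))

/-- Used to glue components around a vertex that a deletion set has failed to remove. -/
lemma ConnIn.union_star {ι : Type*} {p : V} {I : Set ι} {K : ι → Set V}
    (hK : ∀ i ∈ I, ConnIn G (K i)) (hp : ∀ i ∈ I, ∃ q ∈ K i, G.Adj p q) :
    ConnIn G ({p} ∪ ⋃ i ∈ I, K i) := by
  have key : ∀ y ∈ {p} ∪ ⋃ i ∈ I, K i, LinkedIn G ({p} ∪ ⋃ i ∈ I, K i) p y := by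
    rintro y (rfl | hy)
    · exact LinkedIn.refl _ _
    · simp only [Set.mem_iUnion] at hy
      obtain ⟨i, hi, hy⟩ := hy
      obtain ⟨q, hq, hpq⟩ := hp i hi
      have hsub : K i ⊆ {p} ∪ ⋃ i ∈ I, K i :=
        (Set.subset_biUnion_of_mem (u := K) hi).trans Set.subset_union_right
      exact (LinkedIn.of_adj hpq (Or.inl rfl) (hsub hq)).trans
        (((hK i hi).2 q hq y hy).mono hsub)
  exact ⟨⟨p, Or.inl rfl⟩, fun a ha b hb => (key a ha).symm.trans (key b hb)⟩

/-- If the excursions of a connected set `A` outside `R` are replaced by others which make the same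
connections, the result `A'` is connected. -/
lemma ConnIn.reassemble {A A' R : Set V} (hA : ConnIn G A) (hR : A' ∩ R = A ∩ R)
    (hne : (A ∩ R).Nonempty)
    (hlink : ∀ x ∈ A ∩ R, ∀ y ∈ A ∩ R, ∀ a ∈ A \ R, ∀ b ∈ A \ R, G.Adj x a →
      LinkedIn G (A \ R) a b → G.Adj b y → LinkedIn G A' x y)
    (hanch : ∀ y ∈ A' \ R, ∃ x ∈ A ∩ R, LinkedIn G A' x y) : ConnIn G A' := by
  obtain ⟨x₀, hx₀⟩ := hne
  have hA' : A ∩ R ⊆ A' := hR ▸ Set.inter_subset_left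
  -- Invariant along a walk in `A`: a vertex in `R` is already reached inside `A'`; a vertex outside
  -- lies on an excursion that left `R` at `x` through `a`, with `x` reached inside `A'`.
  have inv : ∀ y, LinkedIn G A x₀ y → (y ∈ R → LinkedIn G A' x₀ y) ∧
      (y ∉ R → ∃ x ∈ A ∩ R, ∃ a ∈ A \ R, LinkedIn G A' x₀ x ∧ G.Adj x a ∧
        LinkedIn G (A \ R) a y) := by
    intro y hy
    induction hy with
    | refl => exact ⟨fun _ => LinkedIn.refl _ _, fun h => absurd hx₀.2 h⟩
    | @tail c d _ hcd ih =>
      obtain ⟨hadj, hc, hd⟩ := hcd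
      by_cases hcR : c ∈ R
      · have h1 := ih.1 hcR
        exact ⟨fun hdR => h1.trans (.of_adj hadj (hA' ⟨hc, hcR⟩) (hA' ⟨hd, hdR⟩)),
          fun hdR => ⟨c, ⟨hc, hcR⟩, d, ⟨hd, hdR⟩, h1, hadj, LinkedIn.refl _ _⟩⟩
      · obtain ⟨x, hx, a, ha, h1, h2, h3⟩ := ih.2 hcR
        exact ⟨fun hdR => h1.trans (hlink x hx d ⟨hd, hdR⟩ a ha c ⟨hc, hcR⟩ h2 h3 hadj),
          fun hdR => ⟨x, hx, a, ha, h1, h2, h3.trans (.of_adj hadj ⟨hc, hcR⟩ ⟨hd, hdR⟩)⟩⟩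
  have key : ∀ y ∈ A', LinkedIn G A' x₀ y := by
    intro y hy
    by_cases hyR : y ∈ R
    · have : y ∈ A ∩ R := hR ▸ ⟨hy, hyR⟩
      exact (inv y (hA.2 _ hx₀.1 _ this.1)).1 hyR
    · obtain ⟨x, hx, h⟩ := hanch y ⟨hy, hyR⟩
      exact ((inv x (hA.2 _ hx₀.1 _ hx.1)).1 hx.2).trans h
  exact ⟨⟨x₀, hA' hx₀⟩, fun a ha b hb => (key a ha).symm.trans (key b hb)⟩

/-- A walk from outside of `R` to `R` has a first vertex in `R`. -/
lemma LinkedIn.exists_first {S R : Set V} {x y : V} (h : LinkedIn G S x y) (hx : x ∉ R)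
    (hy : y ∈ R) : ∃ a ∈ S \ R, ∃ b ∈ S ∩ R, LinkedIn G (S \ R) x a ∧ G.Adj a b := by
  have : (∃ a ∈ S \ R, ∃ b ∈ S ∩ R, LinkedIn G (S \ R) x a ∧ G.Adj a b) ∨
      (y ∉ R ∧ LinkedIn G (S \ R) x y) := by
    clear hy
    induction h with
    | refl => exact Or.inr ⟨hx, LinkedIn.refl _ _⟩
    | @tail a b _ hab ih =>
      rcases ih with ih | ⟨ha, h⟩
      · exact Or.inl ih
      by_cases hb : b ∈ R
      · exact Or.inl ⟨a, ⟨hab.2.1, ha⟩, b, ⟨hab.2.2, hb⟩, h, hab.1⟩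
      · exact Or.inr ⟨hb, h.trans (.of_adj hab.1 ⟨hab.2.1, ha⟩ ⟨hab.2.2, hb⟩)⟩
  exact this.resolve_right fun h => h.1 hy

lemma connIn_iff (S : Set V) : (G.induce S).Connected ↔ ConnIn G S := by
  constructor
  · intro h
    obtain ⟨x⟩ := h.nonempty
    refine ⟨⟨x, x.2⟩, fun a ha b hb => ?_⟩
    have := h.preconnected ⟨a, ha⟩ ⟨b, hb⟩
    rw [SimpleGraph.reachable_iff_reflTransGen] at this
    exact Relation.ReflTransGen.lift (p := fun x y => G.Adj x y ∧ x ∈ S ∧ y ∈ S)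
      (fun x : S => (x : V)) (fun a b h => ⟨h, a.2, b.2⟩) _ _ this
  · rintro ⟨⟨x, hx⟩, h⟩
    have : Nonempty S := ⟨⟨x, hx⟩⟩
    refine ⟨fun a b => ?_⟩
    have hab := h a a.2 b b.2
    rw [SimpleGraph.reachable_iff_reflTransGen]
    have : ∀ y, LinkedIn G S a y → ∀ hy : y ∈ S,
        Relation.ReflTransGen (G.induce S).Adj a ⟨y, hy⟩ := by
      intro y hy
      induction hy with
      | refl => exact fun _ => Relation.ReflTransGen.refl
      | tail _ h ih => exact fun hy => (ih h.2.1).tail h.1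
    exact this b hab b.2

end Connectivity

/-! ### Patterns: splitting and trimming minor models -/

lemma exists_selection {α ι : Type*} (I : Set α) (J : Set ι) (P : α → ι → Prop) :
    ∃ J₀ ⊆ J, J₀.encard ≤ I.encard ∧ ∀ i ∈ I, (∃ j ∈ J, P i j) → ∃ j ∈ J₀, P i j := by
  have h : ∀ i : {i // i ∈ I ∧ ∃ j ∈ J, P i j}, ∃ j ∈ J, P i j := fun i => i.2.2
  choose f hfJ hfP using h
  refine ⟨Set.range f, ?_, ?_, fun i hi hj => ⟨f ⟨i, hi, hj⟩, ⟨_, rfl⟩, hfP ⟨i, hi, hj⟩⟩⟩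
  · rintro _ ⟨i, rfl⟩
    exact hfJ i
  · rw [← Set.image_univ]
    refine (Set.encard_image_le _ _).trans ?_
    rw [← (Subtype.val_injective).encard_image]
    refine Set.encard_le_encard ?_
    rintro _ ⟨i, -, rfl⟩
    exact i.2.1

/-- A labeled graph on the vertex set `Fin n`, considered as a candidate for a minor. -/
structure Pattern (L : Type v) where
  /-- the number of vertices -/
  n : ℕ
  /-- the adjacency relation -/
  graph : SimpleGraph (Fin n)
  /-- the labels -/
  lab : Fin n → Set L

namespace Pattern

variable {V : Type z} {L : Type v} {G : SimpleGraph V}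

/-- `H` has a labeled minor model in the subgraph of `G` induced by `S`. -/
def MinorIn (H : Pattern L) (G : SimpleGraph V) (lab : V → Set L) (S : Set V) : Prop :=
  ∃ φ : Fin H.n → Set V, (∀ a, φ a ⊆ S) ∧ (∀ a, ConnIn G (φ a)) ∧
    (∀ a b, a ≠ b → Disjoint (φ a) (φ b)) ∧
    (∀ a b, H.graph.Adj a b → ∃ x ∈ φ a, ∃ y ∈ φ b, G.Adj x y) ∧
    ∀ a, ∀ l ∈ H.lab a, ∃ x ∈ φ a, l ∈ lab x

/-- The pairs of a vertex and one of its labels. -/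
def labPairs (H : Pattern L) : Set (Fin H.n × L) := {p | p.2 ∈ H.lab p.1}

lemma MinorIn.mono {H : Pattern L} {lab lab' : V → Set L} {S S' : Set V}
    (h : H.MinorIn G lab S) (hS : S ⊆ S') (hlab : ∀ x ∈ S, lab x ⊆ lab' x) :
    H.MinorIn G lab' S' := by
  obtain ⟨φ, h1, h2, h3, h4, h5⟩ := h
  refine ⟨φ, fun a => (h1 a).trans hS, h2, h3, h4, fun a l hl => ?_⟩
  obtain ⟨x, hx, hlx⟩ := h5 a l hl
  exact ⟨x, hx, hlab x (h1 a hx) hlx⟩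

/-- The pattern that consists of a single vertex with label set `A`. -/
def single (A : Set L) : Pattern L := ⟨1, ⊥, fun _ => A⟩

lemma connected_single (A : Set L) : (single A).graph.Connected where
  preconnected a b := by
    rw [Subsingleton.elim (α := Fin 1) a b]
  nonempty := ⟨(0 : Fin 1)⟩

lemma minorIn_single {A : Set L} {lab : V → Set L} {S : Set V} :
    (single A).MinorIn G lab S ↔ ∃ K ⊆ S, ConnIn G K ∧ ∀ l ∈ A, ∃ x ∈ K, l ∈ lab x := by
  constructor
  · rintro ⟨φ, h1, h2, -, -, h5⟩
    exact ⟨φ (0 : Fin 1), h1 _, h2 _, h5 (0 : Fin 1)⟩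
  · rintro ⟨K, h1, h2, h3⟩
    exact ⟨fun _ => K, fun _ => h1, fun _ => h2,
      fun a b h => absurd (Subsingleton.elim (α := Fin 1) a b) h, fun a b h => absurd h id,
      fun _ => h3⟩

/-- The union of the branch sets of a connected pattern is connected, so that the model lies in
any part of the host without edges to the rest which it meets. -/
lemma MinorIn.of_connected {H : Pattern L} (hH : H.graph.Connected) {φ : Fin H.n → Set V}
    {S P : Set V} (hφ : ∀ a, φ a ⊆ S) (hconn : ∀ a, ConnIn G (φ a))
    (hadj : ∀ a b, H.graph.Adj a b → ∃ x ∈ φ a, ∃ y ∈ φ b, G.Adj x y)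
    (hP : ∀ x ∈ P, ∀ y ∈ S, G.Adj x y → y ∈ P) {a₀ : Fin H.n} (ha₀ : (φ a₀ ∩ P).Nonempty)
    (a : Fin H.n) : φ a ⊆ P := by
  have h := hH.preconnected a₀ a
  rw [SimpleGraph.reachable_iff_reflTransGen] at h
  induction h with
  | refl => exact (hconn a₀).subset_of_closed (hφ a₀) hP ha₀
  | @tail b c _ hbc ih =>
    obtain ⟨x, hx, y, hy, hxy⟩ := hadj b c hbc
    exact (hconn c).subset_of_closed (hφ c) hP ⟨y, hy, hP x (ih hx) y (hφ c hy) hxy⟩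

/-- The edges of a connected pattern tie its branch sets together, so the model cannot be spread
over two sides without edges between them. -/
lemma MinorIn.split {H : Pattern L} (hH : H.graph.Connected) {lab : V → Set L} {S S₁ S₂ : Set V}
    (h : H.MinorIn G lab S) (hS : S ⊆ S₁ ∪ S₂) (hadj : ∀ x ∈ S₁, ∀ y ∈ S₂, ¬ G.Adj x y) :
    H.MinorIn G lab S₁ ∨ H.MinorIn G lab S₂ := by
  obtain ⟨φ, h1, h2, h3, h4, h5⟩ := h
  obtain ⟨a₀⟩ := hH.nonempty
  obtain ⟨x, hx⟩ := (h2 a₀).1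
  rcases hS (h1 a₀ hx) with hx' | hx'
  · refine Or.inl ⟨φ, MinorIn.of_connected hH h1 h2 h4 (fun a ha b hb hab => ?_) ⟨x, hx, hx'⟩,
      h2, h3, h4, h5⟩
    exact (hS hb).resolve_right fun hb' => hadj a ha b hb' hab
  · refine Or.inr ⟨φ, MinorIn.of_connected hH h1 h2 h4 (fun a ha b hb hab => ?_) ⟨x, hx, hx'⟩,
      h2, h3, h4, h5⟩
    exact (hS hb).resolve_left fun hb' => hadj b hb' a ha hab.symm

lemma MinorIn.split_iUnion {H : Pattern L} (hH : H.graph.Connected) {lab : V → Set L} {S : Set V}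
    {ι : Type*} {I : Set ι} {P : ι → Set V} (h : H.MinorIn G lab S) (hS : S ⊆ ⋃ i ∈ I, P i)
    (hadj : ∀ i ∈ I, ∀ j ∈ I, i ≠ j → ∀ x ∈ P i, ∀ y ∈ P j, ¬ G.Adj x y) :
    ∃ i ∈ I, H.MinorIn G lab (S ∩ P i) := by
  obtain ⟨φ, h1, h2, h3, h4, h5⟩ := h
  obtain ⟨a₀⟩ := hH.nonempty
  obtain ⟨x, hx⟩ := (h2 a₀).1
  have := hS (h1 a₀ hx)
  simp only [Set.mem_iUnion] at this
  obtain ⟨i, hi, hxi⟩ := this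
  refine ⟨i, hi, φ, fun a => Set.subset_inter (h1 a) (MinorIn.of_connected hH h1 h2 h4
    (fun a ha b hb hab => ?_) ⟨x, hx, hxi⟩ a), h2, h3, h4, h5⟩
  have := hS hb
  simp only [Set.mem_iUnion] at this
  obtain ⟨j, hj, hbj⟩ := this
  by_cases hij : i = j
  · exact hij ▸ hbj
  · exact absurd hab (hadj i hi j hj hij a ha b hbj)

/-- In a host that consists of `S₀` and of pieces which are attached to `S₀` at `B` only, a bounded
number of the pieces suffices for a minor model. -/
lemma MinorIn.trim {H : Pattern L} {lab : V → Set L} {S₀ B : Set V} {ι : Type*} {J : Set ι}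
    {W : ι → Set V} (hW : ∀ j ∈ J, ∀ x ∈ W j, ∀ y ∈ S₀, G.Adj x y → y ∈ B)
    (hWW : ∀ i ∈ J, ∀ j ∈ J, i ≠ j → ∀ x ∈ W i, ∀ y ∈ W j, ¬ G.Adj x y)
    (h : H.MinorIn G lab (S₀ ∪ ⋃ j ∈ J, W j)) :
    ∃ J₀ ⊆ J, J₀.encard ≤ H.n * (B.encard * B.encard) + H.n + H.n * H.n + H.labPairs.encard ∧
      H.MinorIn G lab (S₀ ∪ ⋃ j ∈ J₀, W j) := by
  obtain ⟨φ, h1, h2, h3, h4, h5⟩ := h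
  have hcases : ∀ a, ∀ x ∈ φ a, x ∈ S₀ ∨ ∃ j ∈ J, x ∈ W j := by
    intro a x hx
    simpa using h1 a hx
  have hclosed : ∀ a, ∀ j ∈ J, ∀ x ∈ W j, ∀ y ∈ φ a \ S₀, G.Adj x y → y ∈ W j := by
    intro a j hj x hx y hy hxy
    obtain ⟨k, hk, hyk⟩ := (hcases a y hy.1).resolve_left hy.2
    by_cases hjk : j = k
    · exact hjk ▸ hyk
    · exact absurd hxy (hWW j hj k hk hjk x hx y hyk)
  -- One piece is kept for each task that some piece performs: linking two boundary vertices within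
  -- a branch set, containing a branch set, realizing an edge, providing a label. The four summands
  -- of the bound count these tasks.
  obtain ⟨J₁, hJ₁, hc₁, hs₁⟩ := exists_selection ((Set.univ : Set (Fin H.n)) ×ˢ (B ×ˢ B)) J
    fun p j => LinkedIn G (φ p.1 ∩ W j ∪ {p.2.1, p.2.2}) p.2.1 p.2.2
  obtain ⟨J₂, hJ₂, hc₂, hs₂⟩ := exists_selection (Set.univ : Set (Fin H.n)) J
    fun a j => φ a ⊆ W j
  obtain ⟨J₃, hJ₃, hc₃, hs₃⟩ := exists_selection (Set.univ : Set (Fin H.n × Fin H.n)) J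
    fun p j => ∃ x ∈ φ p.1 ∩ W j, ∃ y ∈ φ p.2 ∩ (S₀ ∪ W j), G.Adj x y
  obtain ⟨J₄, hJ₄, hc₄, hs₄⟩ := exists_selection H.labPairs J
    fun p j => ∃ x ∈ φ p.1 ∩ W j, p.2 ∈ lab x
  refine ⟨J₁ ∪ J₂ ∪ J₃ ∪ J₄, by simp [*], ?_, ?_⟩
  · simp only [Set.encard_prod, Set.encard_univ, ENat.card_eq_coe_fintype_card, Fintype.card_prod,
      Fintype.card_fin, Nat.cast_mul] at hc₁ hc₂ hc₃
    refine (Set.encard_union_le _ _).trans (add_le_add ?_ hc₄)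
    refine (Set.encard_union_le _ _).trans (add_le_add ?_ hc₃)
    exact (Set.encard_union_le _ _).trans (add_le_add hc₁ hc₂)
  set J₀ := J₁ ∪ J₂ ∪ J₃ ∪ J₄ with hJ₀
  have e₁ : J₁ ⊆ J₀ := fun _ h => Or.inl (Or.inl (Or.inl h))
  have e₂ : J₂ ⊆ J₀ := fun _ h => Or.inl (Or.inl (Or.inr h))
  have e₃ : J₃ ⊆ J₀ := fun _ h => Or.inl (Or.inr h)
  have e₄ : J₄ ⊆ J₀ := fun _ h => Or.inr h
  have hsub : ∀ j ∈ J₀, W j ⊆ S₀ ∪ ⋃ j ∈ J₀, W j := fun j hj =>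
    (Set.subset_biUnion_of_mem (u := W) hj).trans Set.subset_union_right
  have hJ₀J : J₀ ⊆ J := by simp [*]
  refine ⟨fun a => φ a ∩ (S₀ ∪ ⋃ j ∈ J₀, W j), fun a => Set.inter_subset_right, fun a => ?_,
    fun a b hab => (h3 a b hab).mono Set.inter_subset_left Set.inter_subset_left,
    fun a b hab => ?_, fun a l hl => ?_⟩
  · by_cases hne : (φ a ∩ S₀).Nonempty
    · refine (h2 a).reassemble (R := S₀) ?_ hne ?_ ?_
      · ext x
        simp only [Set.mem_inter_iff, Set.mem_union]
        tauto
      · intro x hx y hy c hc d hd hxc hcd hdy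
        obtain ⟨j, hj, hcj⟩ := (hcases a c hc.1).resolve_left hc.2
        have hd' := hcd.mem_of_closed (hclosed a j hj) hcj
        have hlk : ∃ j ∈ J, LinkedIn G (φ a ∩ W j ∪ {x, y}) x y := by
          refine ⟨j, hj, (LinkedIn.of_adj hxc (by simp) (Or.inl ⟨hc.1, hcj⟩)).trans
            ((hd'.2.mono ?_).trans (.of_adj hdy (Or.inl ⟨hd.1, hd'.1⟩) (by simp)))⟩
          exact fun t ht => Or.inl ⟨ht.1.1, ht.2⟩
        obtain ⟨i, hi, hlk⟩ := hs₁ (a, x, y) ⟨trivial, hW j hj c hcj x hx.2 hxc.symm,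
          hW j hj d hd'.1 y hy.2 hdy⟩ hlk
        refine hlk.mono (Set.union_subset
          (Set.inter_subset_inter_right _ (hsub i (e₁ hi))) ?_)
        rintro t (rfl | rfl)
        · exact ⟨hx.1, Or.inl hx.2⟩
        · exact ⟨hy.1, Or.inl hy.2⟩
      · rintro y ⟨⟨hya, hy⟩, hyS⟩
        simp only [Set.mem_union, Set.mem_iUnion, hyS, false_or] at hy
        obtain ⟨j, hj, hyj⟩ := hy
        obtain ⟨x, hx⟩ := hne
        obtain ⟨c, hc, d, hd, hyc, hcd⟩ :=
          ((h2 a).2 y hya x hx.1).exists_first (R := S₀) hyS hx.2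
        have hc' := hyc.mem_of_closed (hclosed a j (hJ₀J hj)) hyj
        refine ⟨d, hd, LinkedIn.symm ((hc'.2.mono ?_).trans
          (.of_adj hcd ⟨hc.1, hsub j hj hc'.1⟩ ⟨hd.1, Or.inl hd.2⟩))⟩
        exact fun t ht => ⟨ht.1.1, hsub j hj ht.2⟩
    -- A branch set that avoids `S₀` cannot pass between pieces, so one piece contains it, and `J₂`
    -- retains such a piece.
    · have hdisj : ∀ x ∈ φ a, x ∉ S₀ := fun x hx hxS => hne ⟨x, hx, hxS⟩
      obtain ⟨x, hx⟩ := (h2 a).1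
      obtain ⟨j, hj, hxj⟩ := (hcases a x hx).resolve_left (hdisj x hx)
      have hs : φ a ⊆ W j := (h2 a).subset_of_closed (S := φ a \ S₀)
        (fun y hy => ⟨hy, hdisj y hy⟩) (hclosed a j hj) ⟨x, hx, hxj⟩
      obtain ⟨i, hi, hs⟩ := hs₂ a trivial ⟨j, hj, hs⟩
      beta_reduce
      rw [Set.inter_eq_left.2 (hs.trans (hsub i (e₂ hi)))]
      exact h2 a
  · obtain ⟨x, hx, y, hy, hxy⟩ := h4 a b hab
    have key : ∀ a b, ∀ x ∈ φ a, ∀ y ∈ φ b, G.Adj x y → (∃ j ∈ J, x ∈ W j) →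
        ∃ x ∈ φ a ∩ (S₀ ∪ ⋃ j ∈ J₀, W j), ∃ y ∈ φ b ∩ (S₀ ∪ ⋃ j ∈ J₀, W j), G.Adj x y := by
      rintro a b x hx y hy hxy ⟨j, hj, hxj⟩
      have hy' : y ∈ S₀ ∪ W j := by
        by_cases hyS : y ∈ S₀
        · exact Or.inl hyS
        · exact Or.inr (hclosed b j hj x hxj y ⟨hy, hyS⟩ hxy)
      obtain ⟨i, hi, c, hc, d, hd, hcd⟩ := hs₃ (a, b) trivial ⟨j, hj, x, ⟨hx, hxj⟩, y,
        ⟨hy, hy'⟩, hxy⟩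
      exact ⟨c, ⟨hc.1, hsub i (e₃ hi) hc.2⟩, d, ⟨hd.1, hd.2.elim Or.inl (hsub i (e₃ hi) ·)⟩, hcd⟩
    rcases hcases a x hx with hxS | hxj
    · rcases hcases b y hy with hyS | hyj
      · exact ⟨x, ⟨hx, Or.inl hxS⟩, y, ⟨hy, Or.inl hyS⟩, hxy⟩
      · obtain ⟨c, hc, d, hd, hcd⟩ := key b a y hy x hx hxy.symm hyj
        exact ⟨d, hd, c, hc, hcd.symm⟩
    · exact key a b x hx y hy hxy hxj
  · obtain ⟨x, hx, hl'⟩ := h5 a l hl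
    rcases hcases a x hx with hxS | ⟨j, hj, hxj⟩
    · exact ⟨x, ⟨hx, Or.inl hxS⟩, hl'⟩
    · obtain ⟨i, hi, y, hy, hly⟩ := hs₄ (a, l) hl ⟨j, hj, x, ⟨hx, hxj⟩, hl'⟩
      exact ⟨y, ⟨hy.1, hsub i (e₄ hi) hy.2⟩, hly⟩

end Pattern

/-! ### Folios: what a piece contributes across its boundary -/

/-- What a family of partial branch sets in a piece can contribute to a minor model. -/
inductive Feature (N : ℕ) (V : Type z) (L : Type v)
  | link (a : Fin N) (x y : V)
  | whole (a : Fin N)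
  -- `anchor` ensures that no part of a branch set inside the piece is stranded: everything is tied
  -- to a vertex of `K`, the trace of the branch set on the boundary.
  | anchor (a : Fin N) (K : Set V)
  | edge (a b : Fin N)
  | attach (a : Fin N) (y : V)
  | label (a : Fin N) (l : L)

section Trace

variable {V : Type z} {L : Type v} {G : SimpleGraph V} {N : ℕ}

/-- The partial branch sets `ψ` contribute the given feature, with respect to the boundary `B`. -/
def Contributes (G : SimpleGraph V) (lab : V → Set L) (B : Set V) (ψ : Fin N → Set V) :
    Feature N V L → Prop
  | .link a x y => x ∈ B ∧ y ∈ B ∧ LinkedIn G (ψ a ∪ {x, y}) x y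
  | .whole a => ConnIn G (ψ a)
  | .anchor a K => K ⊆ B ∧ ∀ y ∈ ψ a, ∃ x ∈ K, LinkedIn G (ψ a ∪ K) x y
  | .edge a b => ∃ x ∈ ψ a, ∃ y ∈ ψ b, G.Adj x y
  | .attach a y => y ∈ B ∧ ∃ x ∈ ψ a, G.Adj x y
  | .label a l => ∃ x ∈ ψ a, l ∈ lab x

/-- The sets of features contributed by partial models in the piece `W` with boundary `B`. -/
def folio (N : ℕ) (G : SimpleGraph V) (lab : V → Set L) (B W : Set V) :
    Set (Set (Feature N V L)) :=
  {t | ∃ ψ : Fin N → Set V, (∀ a, ψ a ⊆ W) ∧ (∀ a b, a ≠ b → Disjoint (ψ a) (ψ b)) ∧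
    t = {c | Contributes G lab B ψ c}}

/-- Folios ignore labels outside the piece, so comparisons between pieces remain valid for every
labeling of the environment. -/
lemma folio_congr {lab lab' : V → Set L} {B W : Set V} (h : ∀ x ∈ W, lab x = lab' x) :
    folio N G lab B W = folio N G lab' B W := by
  have key : ∀ ψ : Fin N → Set V, (∀ a, ψ a ⊆ W) →
      {c | Contributes G lab B ψ c} = {c | Contributes G lab' B ψ c} := by
    intro ψ hψ
    ext c
    cases c with
    | label a l =>
      refine exists_congr fun x => and_congr_right fun hx => ?_
      rw [h x (hψ a hx)]
    | _ => rfl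
  ext t
  exact exists_congr fun ψ => and_congr_right fun hψ => and_congr_right fun _ => by rw [key ψ hψ]

/-- A piece can be replaced by another one with a larger folio. -/
lemma Pattern.MinorIn.replace {H : Pattern L} {lab : V → Set L} {S₀ B W W' : Set V}
    (hN : H.n ≤ N) (hdisj : Disjoint S₀ W) (hdisj' : Disjoint S₀ W') (hB : B ⊆ S₀)
    (hadj : ∀ x ∈ W, ∀ y ∈ S₀, G.Adj x y → y ∈ B)
    (hfolio : folio N G lab B W ⊆ folio N G lab B W')
    (h : H.MinorIn G lab (S₀ ∪ W)) : H.MinorIn G lab (S₀ ∪ W') := by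
  obtain ⟨φ, h1, h2, h3, h4, h5⟩ := h
  -- Padding with empty sets lets one folio of width `N` serve all patterns with at most `N`
  -- vertices.
  obtain ⟨ψ, hψ⟩ : ∃ ψ : Fin N → Set V,
      ψ = fun i => if h : i.1 < H.n then φ ⟨i.1, h⟩ ∩ W else ∅ := ⟨_, rfl⟩
  have hψφ : ∀ a : Fin H.n, ψ (Fin.castLE hN a) = φ a ∩ W := by
    intro a
    simp [hψ]
  have hmem : {c | Contributes G lab B ψ c} ∈ folio N G lab B W := by
    refine ⟨ψ, fun i => ?_, fun i j hij => ?_, rfl⟩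
    · rw [hψ]
      by_cases h : i.1 < H.n <;> simp [h]
    · by_cases hi : i.1 < H.n
      · by_cases hj : j.1 < H.n
        · simp only [hψ, hi, hj, dif_pos]
          refine (h3 _ _ fun h => hij ?_).mono Set.inter_subset_left Set.inter_subset_left
          exact Fin.ext (Fin.mk.inj_iff.1 h)
        · simp [hψ, hj]
      · simp [hψ, hi]
  obtain ⟨ψ', h1', h3', htr⟩ := hfolio hmem
  have tr : ∀ c, Contributes G lab B ψ c → Contributes G lab B ψ' c := by
    intro c hc
    have : c ∈ {c | Contributes G lab B ψ' c} := htr ▸ hc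
    exact this
  have hcases : ∀ a, ∀ x ∈ φ a, x ∈ S₀ ∨ x ∈ ψ (Fin.castLE hN a) := by
    intro a x hx
    rw [hψφ]
    exact (h1 a hx).imp id fun h => ⟨hx, h⟩
  have hdiff : ∀ a, φ a \ S₀ = ψ (Fin.castLE hN a) := by
    intro a
    ext x
    refine ⟨fun hx => (hcases a x hx.1).resolve_left hx.2, fun hx => ?_⟩
    rw [hψφ] at hx
    exact ⟨hx.1, fun h => Set.disjoint_left.1 hdisj h hx.2⟩
  have hψW : ∀ a, ψ (Fin.castLE hN a) ⊆ W := fun a => hψφ a ▸ Set.inter_subset_right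
  refine ⟨fun a => φ a ∩ S₀ ∪ ψ' (Fin.castLE hN a), fun a => ?_, fun a => ?_, fun a b hab => ?_,
    fun a b hab => ?_, fun a l hl => ?_⟩
  · exact Set.union_subset_union Set.inter_subset_right (h1' _)
  · by_cases hne : (φ a ∩ S₀).Nonempty
    · refine (h2 a).reassemble (R := S₀) ?_ hne ?_ ?_
      · ext x
        have := fun hx : x ∈ ψ' (Fin.castLE hN a) => fun h : x ∈ S₀ =>
          Set.disjoint_left.1 hdisj' h (h1' _ hx)
        simp only [Set.mem_inter_iff, Set.mem_union]
        tauto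
      · intro x hx y hy c hc d hd hxc hcd hdy
        rw [hdiff] at hc hd hcd
        have hxB := hadj c (hψW a hc) x hx.2 hxc.symm
        have hyB := hadj d (hψW a hd) y hy.2 hdy
        obtain ⟨-, -, h⟩ := tr (.link (Fin.castLE hN a) x y) ⟨hxB, hyB,
          (LinkedIn.of_adj hxc (by simp) (Or.inl hc)).trans
          ((hcd.mono Set.subset_union_left).trans (.of_adj hdy (Or.inl hd) (by simp)))⟩
        refine h.mono (Set.union_subset Set.subset_union_right ?_)
        rintro t (rfl | rfl)
        · exact Or.inl hx
        · exact Or.inl hy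
      · have hanch : Contributes G lab B ψ (.anchor (Fin.castLE hN a) (φ a ∩ B)) := by
          refine ⟨Set.inter_subset_right, fun y hy => ?_⟩
          rw [← hdiff] at hy
          obtain ⟨x, hx⟩ := hne
          obtain ⟨c, hc, d, hd, hyc, hcd⟩ :=
            ((h2 a).2 y hy.1 x hx.1).exists_first (R := S₀) hy.2 hx.2
          have hc' := hc
          rw [hdiff] at hyc hc
          have hdB : d ∈ φ a ∩ B := ⟨hd.1, hadj c (hψW a hc) d hd.2 hcd⟩
          exact ⟨d, hdB, LinkedIn.symm ((hyc.mono Set.subset_union_left).trans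
            (.of_adj hcd (Or.inl hc) (Or.inr hdB)))⟩
        rintro y ⟨hy, hyS⟩
        have hy' : y ∈ ψ' (Fin.castLE hN a) := hy.resolve_left fun h => hyS h.2
        obtain ⟨x, hx, hxy⟩ := (tr _ hanch).2 y hy'
        have hsub : φ a ∩ B ⊆ φ a ∩ S₀ := Set.inter_subset_inter_right _ hB
        exact ⟨x, hsub hx, hxy.mono
          (Set.union_subset Set.subset_union_right (hsub.trans Set.subset_union_left))⟩
    · have he : φ a ∩ S₀ = ∅ := Set.not_nonempty_iff_eq_empty.1 hne
      have hw : ψ (Fin.castLE hN a) = φ a := by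
        rw [← hdiff, sdiff_eq_left, Set.disjoint_iff_inter_eq_empty, he]
      beta_reduce
      rw [he, Set.empty_union]
      exact tr (.whole (Fin.castLE hN a)) (show ConnIn G _ from hw ▸ h2 a)
  · have hc : Fin.castLE hN a ≠ Fin.castLE hN b := fun h => hab (Fin.castLE_injective hN h)
    rw [Set.disjoint_union_left, Set.disjoint_union_right, Set.disjoint_union_right]
    exact ⟨⟨(h3 a b hab).mono Set.inter_subset_left Set.inter_subset_left,
      hdisj'.mono Set.inter_subset_right (h1' _)⟩,
      hdisj'.symm.mono (h1' _) Set.inter_subset_right, h3' _ _ hc⟩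
  · obtain ⟨x, hx, y, hy, hxy⟩ := h4 a b hab
    rcases hcases a x hx with hxS | hxψ
    · rcases hcases b y hy with hyS | hyψ
      · exact ⟨x, Or.inl ⟨hx, hxS⟩, y, Or.inl ⟨hy, hyS⟩, hxy⟩
      · obtain ⟨-, t, ht, htx⟩ := tr (.attach (Fin.castLE hN b) x)
          ⟨hadj y (hψW b hyψ) x hxS hxy.symm, y, hyψ, hxy.symm⟩
        exact ⟨x, Or.inl ⟨hx, hxS⟩, t, Or.inr ht, htx.symm⟩
    · rcases hcases b y hy with hyS | hyψ
      · obtain ⟨-, t, ht, htx⟩ := tr (.attach (Fin.castLE hN a) y)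
          ⟨hadj x (hψW a hxψ) y hyS hxy, x, hxψ, hxy⟩
        exact ⟨t, Or.inr ht, y, Or.inl ⟨hy, hyS⟩, htx⟩
      · obtain ⟨s, hs, t, ht, hst⟩ := tr (.edge (Fin.castLE hN a) (Fin.castLE hN b))
          ⟨x, hxψ, y, hyψ, hxy⟩
        exact ⟨s, Or.inr hs, t, Or.inr ht, hst⟩
  · obtain ⟨x, hx, hlx⟩ := h5 a l hl
    rcases hcases a x hx with hxS | hxψ
    · exact ⟨x, Or.inl ⟨hx, hxS⟩, hlx⟩
    · obtain ⟨t, ht, hlt⟩ := tr (.label (Fin.castLE hN a) l) ⟨x, hxψ, hlx⟩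
      exact ⟨t, Or.inr ht, hlt⟩

/-- The features that involve only boundary vertices in `B` and labels in `T`. -/
def featuresOver (N : ℕ) (B : Set V) (T : Set L) : Set (Feature N V L) :=
  Set.range (fun p : Fin N × B × B => .link p.1 p.2.1 p.2.2) ∪
  Set.range (fun a : Fin N => .whole a) ∪
  Set.range (fun p : Fin N × Set.powerset B => .anchor p.1 p.2) ∪
  Set.range (fun p : Fin N × Fin N => .edge p.1 p.2) ∪
  Set.range (fun p : Fin N × B => .attach p.1 p.2) ∪
  Set.range (fun p : Fin N × T => .label p.1 p.2)

/-- A bound for the number of features over `b` boundary vertices and `t` labels. -/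
def featureBound (N b t : ℕ) : ℕ := N * (b * b) + N + N * 2 ^ b + N * N + N * b + N * t

lemma encard_range_le_natCard {α β : Type*} [Finite α] (f : α → β) {c : ℕ}
    (h : Nat.card α ≤ c) : (Set.range f).encard ≤ c := by
  rw [← Set.image_univ]
  refine (Set.encard_image_le _ _).trans ?_
  rw [Set.encard_univ, ENat.card_eq_coe_natCard]
  exact_mod_cast h

lemma encard_featuresOver_le {B : Set V} {T : Set L} {b t : ℕ} (hB : B.encard ≤ b)
    (hT : T.encard ≤ t) : (featuresOver N B T).encard ≤ featureBound N b t := by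
  obtain ⟨hBf, hB⟩ := Set.encard_le_coe_iff_finite_ncard_le.1 hB
  obtain ⟨hTf, hT⟩ := Set.encard_le_coe_iff_finite_ncard_le.1 hT
  have := hBf.to_subtype
  have := hTf.to_subtype
  have : Finite (Set.powerset B) := hBf.finite_subsets.to_subtype
  have hp : (Set.powerset B).ncard ≤ 2 ^ b := by
    rw [Set.ncard_powerset B hBf]
    exact Nat.pow_le_pow_right two_pos hB
  unfold featuresOver featureBound
  push_cast
  refine (Set.encard_union_le _ _).trans (add_le_add ?_ ?_)
  refine (Set.encard_union_le _ _).trans (add_le_add ?_ ?_)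
  refine (Set.encard_union_le _ _).trans (add_le_add ?_ ?_)
  refine (Set.encard_union_le _ _).trans (add_le_add ?_ ?_)
  refine (Set.encard_union_le _ _).trans (add_le_add ?_ ?_)
  all_goals
    norm_cast
    refine encard_range_le_natCard _ ?_
    simp only [Nat.card_prod, Nat.card_eq_fintype_card, Fintype.card_prod, Fintype.card_fin,
      Nat.card_coe_set_eq]
    try gcongr

/-- Makes the number of folios finite: over boundedly many boundary vertices and labels, a folio is
a set of subsets of a bounded set of features. -/
lemma folio_subset {lab : V → Set L} {B W : Set V} {T : Set L} (h : ∀ x ∈ W, lab x ⊆ T) :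
    folio N G lab B W ⊆ (featuresOver N B T).powerset := by
  rintro _ ⟨ψ, h1, -, rfl⟩ c hc
  unfold featuresOver
  cases c with
  | link a x y => exact Or.inl (Or.inl (Or.inl (Or.inl (Or.inl ⟨(a, ⟨x, hc.1⟩, ⟨y, hc.2.1⟩),
        rfl⟩))))
  | whole a => exact Or.inl (Or.inl (Or.inl (Or.inl (Or.inr ⟨a, rfl⟩))))
  | anchor a K => exact Or.inl (Or.inl (Or.inl (Or.inr ⟨(a, ⟨K, hc.1⟩), rfl⟩)))
  | edge a b => exact Or.inl (Or.inl (Or.inr ⟨(a, b), rfl⟩))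
  | attach a y => exact Or.inl (Or.inr ⟨(a, ⟨y, hc.1⟩), rfl⟩)
  | label a l =>
    obtain ⟨x, hx, hl⟩ := hc
    exact Or.inr ⟨(a, ⟨l, h x (h1 a hx) hl⟩), rfl⟩

lemma encard_powerset_le {α : Type*} {S : Set α} {c : ℕ} (h : S.encard ≤ c) :
    S.powerset.encard ≤ (2 ^ c : ℕ) := by
  obtain ⟨hf, h⟩ := Set.encard_le_coe_iff_finite_ncard_le.1 h
  refine Set.encard_le_coe_iff_finite_ncard_le.2 ⟨hf.finite_subsets, ?_⟩
  rw [Set.ncard_powerset S hf]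
  exact Nat.pow_le_pow_right two_pos h

end Trace

/-! ### Frames, domination and representative label sets -/

/-- A labeled host graph with a family `fam` of patterns that have to be controlled, some of which,
the patterns in `F`, must not occur after the deletion. The label `spare` is not used by the
host. -/
structure Frame (V : Type z) (L : Type v) where
  /-- the host graph -/
  G : SimpleGraph V
  /-- the labels of the host graph -/
  lab : V → Set L
  /-- the forbidden minors -/
  F : Set (Pattern L)
  /-- the controlled patterns -/
  fam : Set (Pattern L)
  /-- an unused label -/
  spare : L

/-- `lab` restricted to the label set `T` inside of `D`, and `mu` outside of `D`. -/
def labelsOn {V : Type z} {L : Type v} (lab : V → Set L) (D : Set V) (T : Set L) (mu : V → Set L) :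
    V → Set L :=
  fun x => {l | (x ∈ D ∧ l ∈ lab x ∧ l ∈ T) ∨ (x ∉ D ∧ l ∈ mu x)}

section LabelsOn

variable {V : Type z} {L : Type v} {lab : V → Set L} {D : Set V} {T : Set L} {mu : V → Set L}

lemma labelsOn_of_mem {x : V} (hx : x ∈ D) : labelsOn lab D T mu x = lab x ∩ T := by
  ext l
  simp [labelsOn, hx]

lemma labelsOn_of_notMem {x : V} (hx : x ∉ D) : labelsOn lab D T mu x = mu x := by
  ext l
  simp [labelsOn, hx]

lemma labelsOn_mono {T' : Set L} (hT : T ⊆ T') (x : V) :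
    labelsOn lab D T mu x ⊆ labelsOn lab D T' mu x := by
  rintro l (⟨h1, h2, h3⟩ | h)
  · exact Or.inl ⟨h1, h2, hT h3⟩
  · exact Or.inr h

end LabelsOn

namespace Frame

variable {V : Type z} {L : Type v} (Φ : Frame V L)

/-- The set `S` contains no minor in `F`. -/
def Free (S : Set V) : Prop := ∀ H ∈ Φ.F, ¬ H.MinorIn Φ.G (fun _ => ∅) S

/-- The minimum number of vertices in `D` that hit all minors in `F`. -/
noncomputable def opt (D : Set V) : ℕ := sInf (Set.ncard '' {Y | Y ⊆ D ∧ Φ.Free (D \ Y)})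

/-- After the deletion of `Y` from `D`, no controlled pattern occurs in `D` together with the
unlabeled boundary `B`, when only labels in `T` are taken into account. -/
def Adm (D B : Set V) (T : Set L) (Y : Set V) : Prop :=
  ∀ H ∈ Φ.fam, ¬ H.MinorIn Φ.G (labelsOn Φ.lab D T fun _ => ∅) (B ∪ D \ Y)

/-- In every environment `R` of `D` with boundary `B`, the controlled patterns that occur after the
deletion of `Z` occur after the deletion of `Y`, even with the labels of `D` restricted to `T`. -/
def Dom (D B : Set V) (T : Set L) (Y Z : Set V) : Prop :=
  ∀ R, B ⊆ R → Disjoint R D → (∀ x ∈ D, ∀ y ∈ R, Φ.G.Adj x y → y ∈ B) →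
    ∀ mu : V → Set L, ∀ H ∈ Φ.fam, H.MinorIn Φ.G (labelsOn Φ.lab D Set.univ mu) (R ∪ D \ Z) →
      H.MinorIn Φ.G (labelsOn Φ.lab D T mu) (R ∪ D \ Y)

/-- The label set `T` is representative for deletion sets in `D` which exceed the optimum by at
most `k`. -/
def Good (D B : Set V) (k : ℕ) (T : Set L) : Prop :=
  ∀ Y ⊆ D, Y.ncard ≤ Φ.opt D + k → Φ.Adm D B T Y →
    ∃ Z ⊆ D, Z.ncard ≤ Y.ncard ∧ Φ.Dom D B T Y Z

/-- The assumptions on a frame. -/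
structure Valid (N m s : ℕ) : Prop where
  F_subset : Φ.F ⊆ Φ.fam
  connected : ∀ H ∈ Φ.fam, H.graph.Connected
  card_le : ∀ H ∈ Φ.fam, H.n ≤ N
  labPairs_le : ∀ H ∈ Φ.fam, H.labPairs.encard ≤ m
  unlabeled : ∀ H ∈ Φ.F, ∀ a, H.lab a = ∅
  single_mem : ∀ A : Set L, Φ.spare ∉ A → A.encard = s → Pattern.single A ∈ Φ.fam
  -- With the spare label placed on the boundary, these patterns detect which labels are connected
  -- to it; see `Valid.adm_of_dom`.
  pair_mem : ∀ l, l ≠ Φ.spare → Pattern.single {Φ.spare, l} ∈ Φ.fam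
  spare_notMem : ∀ x, Φ.spare ∉ Φ.lab x

variable {Φ} {N m s : ℕ}

lemma Free.mono {S S' : Set V} (h : Φ.Free S') (hS : S ⊆ S') : Φ.Free S :=
  fun H hH hm => h H hH (hm.mono hS fun _ _ => subset_rfl)

lemma Valid.minorIn_unlabeled (hΦ : Φ.Valid N m s) {H : Pattern L} (hH : H ∈ Φ.F)
    {lab lab' : V → Set L} {S : Set V} (h : H.MinorIn Φ.G lab S) : H.MinorIn Φ.G lab' S := by
  obtain ⟨φ, h1, h2, h3, h4, -⟩ := h
  refine ⟨φ, h1, h2, h3, h4, fun a l hl => ?_⟩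
  rw [hΦ.unlabeled H hH] at hl
  exact hl.elim

lemma Valid.free_of_adm (hΦ : Φ.Valid N m s) {D B : Set V} {T : Set L} {Y : Set V}
    (h : Φ.Adm D B T Y) : Φ.Free (B ∪ D \ Y) :=
  fun H hH hm => h H (hΦ.F_subset hH) (hΦ.minorIn_unlabeled hH hm)

lemma Valid.free_iUnion (hΦ : Φ.Valid N m s) {ι : Type*} {I : Set ι} {P : ι → Set V}
    (hadj : ∀ i ∈ I, ∀ j ∈ I, i ≠ j → ∀ x ∈ P i, ∀ y ∈ P j, ¬ Φ.G.Adj x y)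
    (h : ∀ i ∈ I, Φ.Free (P i)) : Φ.Free (⋃ i ∈ I, P i) := by
  intro H hH hm
  obtain ⟨i, hi, hm⟩ := hm.split_iUnion (hΦ.connected H (hΦ.F_subset hH)) subset_rfl hadj
  exact h i hi H hH (hm.mono Set.inter_subset_right fun _ _ => subset_rfl)

lemma Valid.free_empty (hΦ : Φ.Valid N m s) : Φ.Free ∅ := by
  rintro H hH ⟨φ, h1, h2, -⟩
  obtain ⟨a⟩ := (hΦ.connected H (hΦ.F_subset hH)).nonempty
  obtain ⟨x, hx⟩ := (h2 a).1
  exact h1 a hx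

lemma opt_le {D Y : Set V} (hY : Y ⊆ D) (h : Φ.Free (D \ Y)) : Φ.opt D ≤ Y.ncard :=
  Nat.sInf_le ⟨Y, ⟨hY, h⟩, rfl⟩

lemma Valid.exists_opt (hΦ : Φ.Valid N m s) (D : Set V) :
    ∃ Y ⊆ D, Φ.Free (D \ Y) ∧ Y.ncard = Φ.opt D := by
  have : (Set.ncard '' {Y | Y ⊆ D ∧ Φ.Free (D \ Y)}).Nonempty :=
    ⟨_, D, ⟨subset_rfl, by simpa using hΦ.free_empty⟩, rfl⟩
  obtain ⟨Y, ⟨h1, h2⟩, h3⟩ := Nat.sInf_mem this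
  exact ⟨Y, h1, h2, h3⟩

lemma opt_eq_zero {D : Set V} (h : Φ.Free D) : Φ.opt D = 0 := by
  have := opt_le (Φ := Φ) (Set.empty_subset D) (by simpa using h)
  simpa using this

/-- Adding the vertex to a solution for the rest gives a solution. This is why an undeleted vertex
that moves to the boundary raises the excess from `k` to `k + 1`. -/
lemma Valid.opt_le_diff_singleton (hΦ : Φ.Valid N m s) {D : Set V} {x : V} (hx : x ∈ D) :
    Φ.opt D ≤ Φ.opt (D \ {x}) + 1 := by
  obtain ⟨Y, h1, h2, h3⟩ := hΦ.exists_opt (D \ {x})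
  rw [← h3]
  refine (opt_le (Y := insert x Y) ?_ ?_).trans (Set.ncard_insert_le _ _)
  · exact Set.insert_subset hx (h1.trans Set.sdiff_subset)
  · rwa [Set.sdiff_sdiff, Set.singleton_union] at h2

lemma Adm.mono {D B : Set V} {T T' : Set L} {Y : Set V} (h : Φ.Adm D B T' Y) (hT : T ⊆ T') :
    Φ.Adm D B T Y :=
  fun H hH hm => h H hH (hm.mono subset_rfl fun x _ => labelsOn_mono hT x)

lemma Dom.mono {D B : Set V} {T T' : Set L} {Y Z : Set V} (h : Φ.Dom D B T Y Z) (hT : T ⊆ T') :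
    Φ.Dom D B T' Y Z :=
  fun R h1 h2 h3 mu H hH hm =>
    (h R h1 h2 h3 mu H hH hm).mono subset_rfl fun x _ => labelsOn_mono hT x

/-- A larger label set strengthens the hypothesis `Adm` and weakens the conclusion `Dom`, so label
sets from different sources may simply be united. -/
lemma Good.mono {D B : Set V} {k : ℕ} {T T' : Set L} (h : Φ.Good D B k T) (hT : T ⊆ T') :
    Φ.Good D B k T' := by
  intro Y hY hk hadm
  obtain ⟨Z, h1, h2, h3⟩ := h Y hY hk (hadm.mono hT)
  exact ⟨Z, h1, h2, h3.mono hT⟩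

/-- Domination passes from `D \ {p}` to `D` when `p` is deleted. -/
lemma Good.exists_of_mem [Finite V] {D B : Set V} {k : ℕ} {T : Set L} {p : V} (hp : p ∈ D)
    (h : Φ.Good (D \ {p}) B k T) {Y : Set V} (hY : Y ⊆ D) (hpY : p ∈ Y)
    (hk : Y.ncard ≤ Φ.opt (D \ {p}) + k + 1) (hadm : Φ.Adm D B T Y) :
    ∃ Z ⊆ D, Z.ncard ≤ Y.ncard ∧ Φ.Dom D B T Y Z := by
  have hcard := Set.ncard_sdiff_singleton_add_one hpY
  have hset : ∀ Z, (D \ {p}) \ Z = D \ insert p Z := fun Z => by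
    rw [Set.sdiff_sdiff, Set.singleton_union]
  have hYp : insert p (Y \ {p}) = Y := by simp [hpY]
  obtain ⟨Z, hZ, hZY, hdom⟩ := h (Y \ {p}) (Set.sdiff_subset_sdiff_left hY) (by omega) (by
    intro H hH hm
    refine hadm H hH (hm.mono (by rw [hset, hYp]) ?_)
    rintro x hx l (⟨h1, h2⟩ | ⟨h1, h2⟩)
    · exact Or.inl ⟨h1.1, h2⟩
    · exact h2.elim)
  refine ⟨insert p Z, Set.insert_subset hp (hZ.trans Set.sdiff_subset), ?_, ?_⟩
  · have := Set.ncard_insert_le p Z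
    omega
  · intro R hBR hRD hR mu H hH hm
    have hpR : p ∉ R := fun h => Set.disjoint_left.1 hRD h hp
    have hmem : ∀ x ∈ R ∪ (D \ {p}) \ Z, (x ∈ D ↔ x ∈ D \ {p}) := by
      rintro x (hx | hx)
      · have : x ∉ D := fun h => Set.disjoint_left.1 hRD hx h
        simp [this]
      · simp [hx.1.1, hx.1.2]
    have hmem' : ∀ x ∈ R ∪ (D \ {p}) \ (Y \ {p}), (x ∈ D ↔ x ∈ D \ {p}) := by
      rintro x (hx | hx)
      · have : x ∉ D := fun h => Set.disjoint_left.1 hRD hx h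
        simp [this]
      · simp [hx.1.1, hx.1.2]
    have := hdom R hBR (hRD.mono_right Set.sdiff_subset) (fun x hx y hy => hR x hx.1 y hy) mu H hH
      (hm.mono (by rw [hset]) fun x hx => by
        rw [← hset] at hx
        simp only [labelsOn, hmem x hx]
        exact subset_rfl)
    exact this.mono (by rw [hset, hYp]) fun x hx => by
      simp only [labelsOn, hmem' x hx]
      exact subset_rfl

/-- Representative labels for `D` are obtained from those for `D \ {p}`, once with `p` deleted and
once with `p` in the boundary. -/
lemma Valid.good_of_vertex [Finite V] (hΦ : Φ.Valid N m s) {D B : Set V} {k : ℕ}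
    {T₁ T₂ T₃ : Set L} {p : V} (hp : p ∈ D)
    (h₁ : Φ.Good (D \ {p}) B k T₁) (h₂ : Φ.Good (D \ {p}) (insert p B) (k + 1) T₂)
    (h₃ : Φ.lab p ⊆ T₃ ∨ ∃ A ⊆ Φ.lab p ∩ T₃, A.encard = s) :
    Φ.Good D B k (T₁ ∪ T₂ ∪ T₃) := by
  intro Y hY hk hadm
  have hopt := hΦ.opt_le_diff_singleton hp
  by_cases hpY : p ∈ Y
  · exact (h₁.mono (Set.subset_union_left.trans Set.subset_union_left)).exists_of_mem hp hY hpY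
      (by omega) hadm
  have hset : ∀ Z ⊆ D \ {p}, ∀ R : Set V, insert p R ∪ (D \ {p}) \ Z = R ∪ D \ Z := by
    intro Z hZ R
    ext x
    by_cases hx : x = p
    · subst hx
      have : x ∉ Z := fun h => (hZ h).2 rfl
      simp [hp, this]
    · simp [hx]
  have hYp : Y ⊆ D \ {p} := fun x hx => ⟨hY hx, fun h => hpY (h ▸ hx)⟩
  -- If `T₃` contained `s` labels of the surviving vertex `p`, then `{p}` alone would model a
  -- controlled single-vertex pattern.
  have hlab : Φ.lab p ⊆ T₃ := by
    refine h₃.resolve_right ?_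
    rintro ⟨A, hA, hAs⟩
    refine hadm _ (hΦ.single_mem A (fun h => hΦ.spare_notMem p (hA h).1) hAs) ?_
    refine Pattern.minorIn_single.2 ⟨{p}, ?_, connIn_singleton p, fun l hl => ⟨p, rfl, ?_⟩⟩
    · rintro _ rfl
      exact Or.inr ⟨hp, hpY⟩
    · exact Or.inl ⟨hp, (hA hl).1, Or.inr (hA hl).2⟩
  obtain ⟨Z, hZ, hZY, hdom⟩ := (h₂.mono (T' := T₁ ∪ T₂ ∪ T₃)
      (Set.subset_union_right.trans Set.subset_union_left)) Y hYp (by omega) (by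
    intro H hH hm
    refine hadm H hH (hm.mono (by rw [hset Y hYp]) ?_)
    rintro x hx l (⟨h1, h2⟩ | ⟨h1, h2⟩)
    · exact Or.inl ⟨h1.1, h2⟩
    · exact h2.elim)
  refine ⟨Z, hZ.trans Set.sdiff_subset, hZY, ?_⟩
  intro R hBR hRD hR mu H hH hm
  classical
  have hpR : p ∉ R := fun h => Set.disjoint_left.1 hRD h hp
  -- The vertex `p` is now part of the environment and its labels are supplied through `mu`; the
  -- definition of `Dom` allows arbitrary labels there for this purpose.
  have := hdom (insert p R) (Set.insert_subset_insert hBR) ?_ ?_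
    (fun x => if x = p then Φ.lab p else mu x) H hH (hm.mono (by rw [hset Z hZ]) ?_)
  · refine this.mono (by rw [hset Y hYp]) ?_
    rintro x hx l (⟨h1, h2⟩ | ⟨h1, h2⟩)
    · exact Or.inl ⟨h1.1, h2⟩
    · beta_reduce at h2
      by_cases hxp : x = p
      · subst hxp
        rw [if_pos rfl] at h2
        exact Or.inl ⟨hp, h2, Or.inr (hlab h2)⟩
      · rw [if_neg hxp] at h2
        exact Or.inr ⟨fun h => h1 ⟨h, hxp⟩, h2⟩
  · rw [Set.disjoint_insert_left]
    exact ⟨fun h => h.2 rfl, hRD.mono_right Set.sdiff_subset⟩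
  · rintro x hx y (rfl | hy) hxy
    · exact Or.inl rfl
    · exact Or.inr (hR x hx.1 y hy hxy)
  · rintro x hx l (⟨h1, h2⟩ | ⟨h1, h2⟩)
    · by_cases hxp : x = p
      · subst hxp
        exact Or.inr ⟨fun h => h.2 rfl, by simpa using h2.1⟩
      · exact Or.inl ⟨⟨h1, hxp⟩, h2⟩
    · by_cases hxp : x = p
      · exact absurd hp (hxp ▸ h1)
      · exact Or.inr ⟨fun h => h1 h.1, by simpa [hxp] using h2⟩

section Pieces

variable {ι : Type*} [Fintype ι] {P : ι → Set V}

lemma ncard_eq_sum [Finite V] (hP : ∀ i j, i ≠ j → Disjoint (P i) (P j)) {Y : Set V}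
    (hY : Y ⊆ ⋃ i, P i) : Y.ncard = ∑ i, (Y ∩ P i).ncard := by
  have : Y = ⋃ i, Y ∩ P i := by
    rw [← Set.inter_iUnion, Set.inter_eq_left.2 hY]
  conv_lhs => rw [this]
  rw [Set.ncard_iUnion_of_finite (fun i => Set.toFinite _), finsum_eq_sum_of_fintype]
  exact fun i j hij => (hP i j hij).mono Set.inter_subset_right Set.inter_subset_right

/-- Solutions for pieces without edges between them combine, because forbidden patterns are
connected. Hence the excesses over the optima of the pieces add up to at most the total excess. -/
lemma Valid.opt_iUnion_le [Finite V] (hΦ : Φ.Valid N m s)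
    (hadj : ∀ i j, i ≠ j → ∀ x ∈ P i, ∀ y ∈ P j, ¬ Φ.G.Adj x y) :
    Φ.opt (⋃ i, P i) ≤ ∑ i, Φ.opt (P i) := by
  choose Y h1 h2 h3 using fun i => hΦ.exists_opt (P i)
  refine (opt_le (Y := ⋃ i, Y i) (Set.iUnion_mono h1) ?_).trans ?_
  · have := hΦ.free_iUnion (I := Set.univ) (P := fun i => P i \ Y i)
      (fun i _ j _ hij x hx y hy => hadj i j hij x hx.1 y hy.1) fun i _ => h2 i
    refine this.mono ?_
    rintro x ⟨hx, hxY⟩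
    simp only [Set.mem_iUnion, not_exists] at hx hxY ⊢
    obtain ⟨i, hi⟩ := hx
    exact ⟨i, trivial, hi, hxY i⟩
  · refine (Set.ncard_iUnion_le_of_fintype _).trans (le_of_eq ?_)
    exact Finset.sum_congr rfl fun i _ => h3 i

end Pieces

end Frame

/-! ### Dropping pieces and domination of unions -/

/-- The part of `W` that is connected to the boundary `B`. -/
def attached {V : Type z} (G : SimpleGraph V) (B W : Set V) : Set V :=
  {x | x ∈ W ∧ ∃ y ∈ B, LinkedIn G (W ∪ B) y x}

section Attached

variable {V : Type z} {G : SimpleGraph V} {B W : Set V}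

lemma attached_subset : attached G B W ⊆ W := fun _ h => h.1

lemma mem_attached_of_adj {x y : V} (hx : x ∈ W) (hy : y ∈ B ∪ attached G B W)
    (hxy : G.Adj y x) : x ∈ attached G B W := by
  rcases hy with hy | ⟨hyW, t, ht, hty⟩
  · exact ⟨hx, y, hy, .of_adj hxy (Or.inr hy) (Or.inl hx)⟩
  · exact ⟨hx, t, ht, hty.trans (.of_adj hxy (Or.inl hyW) (Or.inl hx))⟩

end Attached

namespace Frame

variable {V : Type z} {L : Type v} {Φ : Frame V L} {N m s : ℕ}

/-- A number of pieces that suffices for every model of a controlled pattern. -/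
def pieceBound (N m b : ℕ) : ℕ := N * (b * b) + N + N * N + m

section Union

variable {ι : Type*} {P : ι → Set V}

/-- A piece can be dropped when sufficiently many remaining pieces have the same folio. -/
lemma Valid.drop_piece (hΦ : Φ.Valid N m s) {D B R : Set V} {b : ℕ} (hb : B.encard ≤ b)
    (hadj : ∀ i j, i ≠ j → ∀ x ∈ P i, ∀ y ∈ P j, ¬ Φ.G.Adj x y)
    (hdisj : ∀ i j, i ≠ j → Disjoint (P i) (P j))
    (hPD : ∀ i, P i ⊆ D) (hBR : B ⊆ R) (hRD : Disjoint R D)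
    (hR : ∀ x ∈ D, ∀ y ∈ R, Φ.G.Adj x y → y ∈ B) {mu : V → Set L} {H : Pattern L}
    (hH : H ∈ Φ.fam) {Z : ι → Set V} {J K : Set ι} {i : ι} (hi : i ∉ J) (hiK : i ∉ K)
    (hKJ : Disjoint K J) (hadm : Φ.Adm (P i) B Set.univ (Z i))
    (hJ : ∃ J' ⊆ J, (pieceBound N m b : ℕ∞) < J'.encard ∧ ∀ j ∈ J',
      folio N Φ.G Φ.lab B (attached Φ.G B (P i \ Z i)) =
        folio N Φ.G Φ.lab B (attached Φ.G B (P j \ Z j)))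
    (hm : H.MinorIn Φ.G (labelsOn Φ.lab D Set.univ mu)
      ((R ∪ ⋃ k ∈ K, P k \ Z k) ∪ (P i \ Z i) ∪ ⋃ j ∈ J, P j \ Z j)) :
    H.MinorIn Φ.G (labelsOn Φ.lab D Set.univ mu)
      ((R ∪ ⋃ k ∈ K, P k \ Z k) ∪ ⋃ j ∈ J, P j \ Z j) := by
  have hlab : ∀ i, ∀ x ∈ P i, labelsOn Φ.lab D Set.univ mu x = Φ.lab x := by
    intro i x hx
    rw [labelsOn_of_mem (hPD i hx), Set.inter_univ]
  set lab₁ := labelsOn Φ.lab D Set.univ mu with hlab₁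
  set A := attached Φ.G B (P i \ Z i) with hA
  have hAP : A ⊆ P i := attached_subset.trans Set.sdiff_subset
  set R' := R ∪ ⋃ k ∈ K, P k \ Z k with hR'
  have hR'cases : ∀ x ∈ R', x ∈ R ∨ ∃ k ∈ K, x ∈ P k := by
    intro x hx
    simp only [hR', Set.mem_union, Set.mem_iUnion] at hx
    rcases hx with hx | ⟨k, hk, hx⟩
    · exact Or.inl hx
    · exact Or.inr ⟨k, hk, hx.1⟩
  have hPR' : ∀ j ∉ K, ∀ x ∈ P j, ∀ y ∈ R', Φ.G.Adj x y → y ∈ B := by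
    intro j hj x hx y hy hxy
    rcases hR'cases y hy with hy | ⟨k, hk, hy⟩
    · exact hR x (hPD j hx) y hy hxy
    · exact absurd hxy (hadj j k (fun h => hj (h ▸ hk)) x hx y hy)
  have hdR' : ∀ j ∉ K, Disjoint R' (P j) := by
    intro j hj
    rw [Set.disjoint_left]
    intro x hx hxj
    rcases hR'cases x hx with hx | ⟨k, hk, hx⟩
    · exact Set.disjoint_left.1 hRD hx (hPD j hxj)
    · exact Set.disjoint_left.1 (hdisj j k (fun h => hj (h ▸ hk))) hxj hx
  have hJK : ∀ j ∈ J, j ∉ K := fun j hj hk => Set.disjoint_left.1 hKJ hk hj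
  have hij : ∀ j ∈ J, i ≠ j := fun j hj h => hi (h ▸ hj)
  -- The unattached part of piece `i` has no edges to the rest, so a connected pattern using it
  -- would lie entirely inside it, against the admissibility of `Z i`.
  have hm₁ : H.MinorIn Φ.G lab₁ ((R' ∪ A) ∪ ⋃ j ∈ J, P j \ Z j) := by
    refine (hm.split (hΦ.connected H hH) (S₁ := (R' ∪ A) ∪ ⋃ j ∈ J, P j \ Z j)
      (S₂ := (P i \ Z i) \ A) ?_ ?_).resolve_right fun h => hadm H hH (h.mono ?_ ?_)
    · rintro x ((hx | hx) | hx)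
      · exact Or.inl (Or.inl (Or.inl hx))
      · by_cases hxA : x ∈ A
        · exact Or.inl (Or.inl (Or.inr hxA))
        · exact Or.inr ⟨hx, hxA⟩
      · exact Or.inl (Or.inr hx)
    · rintro x hx y ⟨hy, hyA⟩ hxy
      rcases hx with (hx | hx) | hx
      · exact hyA (mem_attached_of_adj hy (Or.inl (hPR' i hiK y hy.1 x hx hxy.symm)) hxy)
      · exact hyA (mem_attached_of_adj hy (Or.inr hx) hxy)
      · simp only [Set.mem_iUnion] at hx
        obtain ⟨j, hj, hx⟩ := hx
        exact hadj i j (hij j hj) y hy.1 x hx.1 hxy.symm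
    · exact fun x hx => Or.inr hx.1
    · intro x hx
      rw [hlab i x hx.1.1, labelsOn_of_mem hx.1.1, Set.inter_univ]
  obtain ⟨J₀, hJ₀, hcard, hm₂⟩ := hm₁.trim (B := B) (fun j hj x hx y hy hxy => by
      rcases hy with hy | hy
      · exact hPR' j (hJK j hj) x hx.1 y hy hxy
      · exact absurd hxy (hadj j i (hij j hj).symm x hx.1 y (hAP hy)))
    (fun j _ k _ hjk x hx y hy => hadj j k hjk x hx.1 y hy.1)
  obtain ⟨J', hJ', hlt, hfol⟩ := hJ
  -- More than `pieceBound` pieces share the folio of piece `i`, but the trimmed model needs at most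
  -- that many; a piece left unused takes over the role of piece `i`.
  obtain ⟨j, hjJ', hjJ₀⟩ : ∃ j ∈ J', j ∉ J₀ := by
    by_contra! hcon
    refine absurd (hlt.trans_le ((Set.encard_le_encard hcon).trans hcard)) (not_lt.2 ?_)
    have h1 := hΦ.card_le H hH
    have h1' : (H.n : ℕ∞) ≤ N := by exact_mod_cast h1
    have h2 := hΦ.labPairs_le H hH
    unfold pieceBound
    push_cast
    gcongr
  have hjJ := hJ' hjJ'
  have hm₃ : H.MinorIn Φ.G lab₁ ((R' ∪ ⋃ j ∈ J₀, P j \ Z j) ∪ A) := by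
    rwa [Set.union_right_comm]
  have hm₄ := hm₃.replace (hΦ.card_le H hH) (B := B)
    (W' := attached Φ.G B (P j \ Z j)) ?_ ?_ ?_ ?_ ?_
  · refine hm₄.mono ?_ fun _ _ => subset_rfl
    rintro x ((hx | hx) | hx)
    · exact Or.inl hx
    · exact Or.inr (Set.biUnion_mono hJ₀ (fun _ _ => subset_rfl) hx)
    · exact Or.inr (Set.mem_biUnion hjJ (attached_subset hx))
  · rw [Set.disjoint_union_left, Set.disjoint_iUnion₂_left]
    exact ⟨(hdR' i hiK).mono_right hAP, fun k hk =>
      (hdisj k i (hij k (hJ₀ hk)).symm).mono Set.sdiff_subset hAP⟩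
  · rw [Set.disjoint_union_left, Set.disjoint_iUnion₂_left]
    have hs : attached Φ.G B (P j \ Z j) ⊆ P j := attached_subset.trans Set.sdiff_subset
    exact ⟨(hdR' j (hJK j hjJ)).mono_right hs, fun k hk =>
      (hdisj k j fun h => hjJ₀ (h ▸ hk)).mono Set.sdiff_subset hs⟩
  · exact fun x hx => Or.inl (Or.inl (hBR hx))
  · rintro x hx y (hy | hy) hxy
    · exact hPR' i hiK x (hAP hx) y hy hxy
    · simp only [Set.mem_iUnion] at hy
      obtain ⟨k, hk, hy⟩ := hy
      exact absurd hxy (hadj i k (hij k (hJ₀ hk)) x (hAP hx) y hy.1)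
  · rw [folio_congr (fun x hx => hlab i x (hAP hx)), hfol j hjJ',
      folio_congr (W := attached Φ.G B (P j \ Z j))
        (fun x hx => hlab j x (attached_subset hx).1)]

variable [Finite ι]

/-- Domination of a union of pieces: on the pieces in `J` piece by piece, on all others by means of
the folios of pieces in `J`. -/
lemma Valid.dom_iUnion (hΦ : Φ.Valid N m s) {B : Set V} {b : ℕ} (hb : B.encard ≤ b)
    (hadj : ∀ i j, i ≠ j → ∀ x ∈ P i, ∀ y ∈ P j, ¬ Φ.G.Adj x y)
    (hdisj : ∀ i j, i ≠ j → Disjoint (P i) (P j)) {T : Set L} {Y : Set V} {Z : ι → Set V}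
    {J : Set ι} (hdom : ∀ j ∈ J, Φ.Dom (P j) B T (Y ∩ P j) (Z j))
    (hfol : ∀ i ∉ J, Φ.Adm (P i) B Set.univ (Z i) ∧
      ∃ J' ⊆ J, (pieceBound N m b : ℕ∞) < J'.encard ∧ ∀ j ∈ J',
        folio N Φ.G Φ.lab B (attached Φ.G B (P i \ Z i)) =
          folio N Φ.G Φ.lab B (attached Φ.G B (P j \ Z j))) :
    Φ.Dom (⋃ i, P i) B T Y (⋃ i, Z i) := by
  intro R hBR hRD hR mu H hH hm
  have hPD : ∀ i, P i ⊆ ⋃ i, P i := Set.subset_iUnion P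
  set D := ⋃ i, P i with hD
  -- Pieces outside `J` are dropped one at a time; those still to be dropped count as environment.
  have hdrop : ∀ K : Set ι, K.Finite → Disjoint K J →
      H.MinorIn Φ.G (labelsOn Φ.lab D Set.univ mu)
        ((R ∪ ⋃ k ∈ K, P k \ Z k) ∪ ⋃ j ∈ J, P j \ Z j) →
      H.MinorIn Φ.G (labelsOn Φ.lab D Set.univ mu) (R ∪ ⋃ j ∈ J, P j \ Z j) := by
    intro K hK
    induction K, hK using Set.Finite.induction_on with
    | empty => intro _ h; simpa using h
    | @insert i K hiK _ ih =>
      intro hKJ h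
      rw [Set.disjoint_insert_left] at hKJ
      refine ih hKJ.2 (hΦ.drop_piece hb hadj hdisj hPD hBR hRD hR hH hKJ.1 hiK hKJ.2
        (hfol i hKJ.1).1 (hfol i hKJ.1).2 (h.mono ?_ fun _ _ => subset_rfl))
      rw [Set.biUnion_insert]
      intro x hx
      simp only [Set.mem_union] at hx ⊢
      tauto
  have hm₁ : H.MinorIn Φ.G (labelsOn Φ.lab D Set.univ mu) (R ∪ ⋃ j ∈ J, P j \ Z j) := by
    refine hdrop Jᶜ (Set.toFinite _) disjoint_compl_left (hm.mono ?_ fun _ _ => subset_rfl)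
    rintro x (hx | ⟨hx, hxZ⟩)
    · exact Or.inl (Or.inl hx)
    · obtain ⟨i, hi⟩ := Set.mem_iUnion.1 hx
      have hxi : x ∈ P i \ Z i := ⟨hi, fun h => hxZ (Set.mem_iUnion.2 ⟨i, h⟩)⟩
      by_cases hiJ : i ∈ J
      · exact Or.inr (Set.mem_biUnion hiJ hxi)
      · exact Or.inl (Or.inr (Set.mem_biUnion (show i ∈ Jᶜ from hiJ) hxi))
  -- In `J`, one piece at a time passes from `Z` to `Y`. The other pieces count as environment, and
  -- `mu` records that labels on the pieces already treated are restricted to `T`.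
  have hrep : ∀ K : Set ι, K.Finite → K ⊆ J →
      H.MinorIn Φ.G (fun x => {l | l ∈ labelsOn Φ.lab D Set.univ mu x ∧ ∀ k ∈ K, x ∈ P k → l ∈ T})
        {x | x ∈ R ∨ (∃ j ∈ J, j ∉ K ∧ x ∈ P j \ Z j) ∨ ∃ j ∈ K, x ∈ P j \ Y} := by
    intro K hK
    induction K, hK using Set.Finite.induction_on with
    | empty =>
      intro _
      refine hm₁.mono ?_ ?_
      · rintro x (hx | hx)
        · exact Or.inl hx
        · simp only [Set.mem_iUnion] at hx
          obtain ⟨j, hj, hx⟩ := hx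
          exact Or.inr (Or.inl ⟨j, hj, id, hx⟩)
      · exact fun x _ l hl => ⟨hl, fun k hk => hk.elim⟩
    | @insert i K hiK _ ih =>
      intro hKJ
      rw [Set.insert_subset_iff] at hKJ
      have h := hdom i hKJ.1
        {x | x ∈ R ∨ (∃ j ∈ J, j ∉ insert i K ∧ x ∈ P j \ Z j) ∨ ∃ j ∈ K, x ∈ P j \ Y}
        (fun x hx => Or.inl (hBR hx)) ?_ ?_
        (fun x => {l | l ∈ labelsOn Φ.lab D Set.univ mu x ∧ ∀ k ∈ K, x ∈ P k → l ∈ T}) H hH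
        ((ih hKJ.2).mono ?_ ?_)
      · refine h.mono ?_ ?_
        · rintro x ((hx | hx | ⟨j, hj, hx⟩) | hx)
          · exact Or.inl hx
          · exact Or.inr (Or.inl hx)
          · exact Or.inr (Or.inr ⟨j, Or.inr hj, hx⟩)
          · exact Or.inr (Or.inr ⟨i, Or.inl rfl, hx.1, fun h => hx.2 ⟨h, hx.1⟩⟩)
        · rintro x - l (⟨h1, h2, h3⟩ | ⟨h1, h2, h3⟩)
          · exact ⟨Or.inl ⟨hPD i h1, h2, trivial⟩, fun _ _ _ => h3⟩
          · refine ⟨h2, ?_⟩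
            rintro k (rfl | hk) hxk
            · exact absurd hxk h1
            · exact h3 k hk hxk
      · rw [Set.disjoint_left]
        rintro x (hx | ⟨j, hj, hji, hx⟩ | ⟨j, hj, hx⟩) hxi
        · exact Set.disjoint_left.1 hRD hx (hPD i hxi)
        · exact Set.disjoint_left.1 (hdisj j i fun h => hji (Or.inl h)) hx.1 hxi
        · exact Set.disjoint_left.1 (hdisj j i fun h => hiK (h ▸ hj)) hx.1 hxi
      · rintro x hxi y (hy | ⟨j, hj, hji, hy⟩ | ⟨j, hj, hy⟩) hxy
        · exact hR x (hPD i hxi) y hy hxy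
        · exact absurd hxy (hadj i j (fun h => hji (Or.inl h.symm)) x hxi y hy.1)
        · exact absurd hxy (hadj i j (fun h => hiK (h ▸ hj)) x hxi y hy.1)
      · rintro x (hx | ⟨j, hj, hjK, hx⟩ | hx)
        · exact Or.inl (Or.inl hx)
        · by_cases hji : j = i
          · exact Or.inr (hji ▸ hx)
          · exact Or.inl (Or.inr (Or.inl ⟨j, hj, fun h => h.elim hji hjK, hx⟩))
        · exact Or.inl (Or.inr (Or.inr hx))
      · intro x _ l hl
        by_cases hxi : x ∈ P i
        · refine Or.inl ⟨hxi, ?_, trivial⟩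
          have := hl.1
          rw [labelsOn_of_mem (hPD i hxi)] at this
          exact this.1
        · exact Or.inr ⟨hxi, hl⟩
  refine (hrep J (Set.toFinite _) subset_rfl).mono ?_ ?_
  · rintro x (hx | ⟨j, hj, hjJ, -⟩ | ⟨j, hj, hx⟩)
    · exact Or.inl hx
    · exact absurd hj hjJ
    · exact Or.inr ⟨hPD j hx.1, hx.2⟩
  · rintro x hx l ⟨hl, hT⟩
    by_cases hxD : x ∈ D
    · rw [labelsOn_of_mem hxD] at hl
      rcases hx with hx | ⟨j, hj, hjJ, -⟩ | ⟨j, hj, hx⟩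
      · exact absurd hxD (Set.disjoint_left.1 hRD hx)
      · exact absurd hj hjJ
      · exact Or.inl ⟨hxD, hl.1, hT j hj hx.1⟩
    · rw [labelsOn_of_notMem hxD] at hl
      exact Or.inr ⟨hxD, hl⟩

end Union

end Frame

/-! ### Rounds of representatives and unions of pieces -/

lemma encard_biUnion_le_mul {ι α : Type*} {J : Set ι} {f : ι → Set α} {n g : ℕ}
    (hJ : J.encard ≤ n) (hf : ∀ j ∈ J, (f j).encard ≤ g) :
    (⋃ j ∈ J, f j).encard ≤ (n * g : ℕ) := by
  obtain ⟨hfin, hn⟩ := Set.encard_le_coe_iff_finite_ncard_le.1 hJ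
  lift J to Finset ι using hfin
  rw [Set.ncard_coe_finset] at hn
  refine (Finset.set_encard_biUnion_le J f).trans ?_
  refine (Finset.sum_le_card_nsmul J _ _ hf).trans ?_
  rw [nsmul_eq_mul]
  push_cast
  gcongr

/-- A bound for the number of labels that are collected in `r` rounds. -/
def roundBound (c : ℕ → ℕ) (g : ℕ) : ℕ → ℕ
  | 0 => 0
  | r + 1 => roundBound c g r + c (roundBound c g r) * g

/-- In each round, add the labels of a new representative for every class of elements that have
not yet been chosen, where the classes depend on the labels collected so far. -/
lemma exists_rounds {ι L C : Type*} (cls : Set L → ι → C) (T : ι → Set L) (g : ℕ)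
    (hT : ∀ i, (T i).encard ≤ g) (c : ℕ → ℕ)
    (hc : ∀ A : Set L, ∀ t : ℕ, A.encard ≤ t → (Set.range (cls A)).encard ≤ c t) :
    ∃ (A : ℕ → Set L) (J : ℕ → Set ι), J 0 = ∅ ∧ Monotone J ∧ Monotone A ∧
      (∀ r, ∀ j ∈ J (r + 1), j ∉ J r → T j ⊆ A (r + 1)) ∧
      (∀ r, ∀ i ∉ J r, ∃ j ∈ J (r + 1), j ∉ J r ∧ cls (A r) i = cls (A r) j) ∧
      ∀ r, (A r).encard ≤ roundBound c g r := by
  have step : ∀ p : Set L × Set ι, ∃ q : Set L × Set ι, p.1 ⊆ q.1 ∧ p.2 ⊆ q.2 ∧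
      (∀ j ∈ q.2, j ∉ p.2 → T j ⊆ q.1) ∧
      (∀ i ∉ p.2, ∃ j ∈ q.2, j ∉ p.2 ∧ cls p.1 i = cls p.1 j) ∧
      ∀ t : ℕ, p.1.encard ≤ t → q.1.encard ≤ (t + c t * g : ℕ) := by
    rintro ⟨A, J⟩
    -- `J'` picks exactly one element from each class that still has unchosen members, so `c t`
    -- bounds its size.
    obtain ⟨J', hJ', hbij⟩ := Set.exists_subset_bijOn Jᶜ (cls A)
    refine ⟨(A ∪ ⋃ j ∈ J', T j, J ∪ J'), Set.subset_union_left, Set.subset_union_left, ?_, ?_, ?_⟩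
    · rintro j (hj | hj) hjJ
      · exact absurd hj hjJ
      · exact (Set.subset_biUnion_of_mem (u := T) hj).trans Set.subset_union_right
    · intro i hi
      obtain ⟨j, hj, hji⟩ := hbij.surjOn ⟨i, hi, rfl⟩
      exact ⟨j, Or.inr hj, hJ' hj, hji.symm⟩
    · intro t ht
      push_cast
      refine (Set.encard_union_le _ _).trans (add_le_add ht ?_)
      refine (encard_biUnion_le_mul (n := c t) ?_ fun j _ => hT j).trans (by push_cast; rfl)
      rw [← hbij.injOn.encard_image]
      exact (Set.encard_le_encard (Set.image_subset_range _ _)).trans (hc A t ht)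
  choose f h1 h2 h3 h4 h5 using step
  have hs : ∀ r, f^[r + 1] (∅, ∅) = f (f^[r] (∅, ∅)) := fun r => Function.iterate_succ_apply' f r _
  refine ⟨fun r => (f^[r] (∅, ∅)).1, fun r => (f^[r] (∅, ∅)).2, rfl,
    monotone_nat_of_le_succ fun r => ?_, monotone_nat_of_le_succ fun r => ?_, fun r => ?_,
    fun r => ?_, fun r => ?_⟩
  · rw [hs]; exact h2 _
  · rw [hs]; exact h1 _
  · beta_reduce; rw [hs]; exact h3 _
  · beta_reduce; rw [hs]; exact h4 _
  · induction r with
    | zero => simp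
    | succ r ih =>
      beta_reduce
      rw [hs]
      exact h5 _ _ ih

namespace Frame

variable {V : Type z} {L : Type v} {Φ : Frame V L} {N m s : ℕ}

/-- The folios of the attached parts of `D \ Z`, for optimal `Z` that leave no controlled pattern
and only labels in `T` in the attached part. -/
def optFolios (Φ : Frame V L) (N : ℕ) (B : Set V) (T : Set L) (D : Set V) :
    Set (Set (Set (Feature N V L))) :=
  {f | ∃ Z ⊆ D, Z.ncard = Φ.opt D ∧ Φ.Adm D B Set.univ Z ∧
    (∀ x ∈ attached Φ.G B (D \ Z), Φ.lab x ⊆ T) ∧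
    f = folio N Φ.G Φ.lab B (attached Φ.G B (D \ Z))}

/-- A bound for the number of folios over `b` boundary vertices and `t` labels. -/
def folioBound (N b t : ℕ) : ℕ := 2 ^ 2 ^ featureBound N b t

/-- A bound for the number of sets of folios over `b` boundary vertices and `t` labels. -/
def classBound (N b t : ℕ) : ℕ := 2 ^ folioBound N b t

/-- The three nested powersets stand for sets of features, folios, and sets of folios. The
restriction of attached labels to `T` in `optFolios` keeps the features bounded. -/
lemma encard_range_optFolios_le {ι : Type*} {P : ι → Set V} {B : Set V} {b : ℕ}
    (hb : B.encard ≤ b) (T : Set L) (t : ℕ) (ht : T.encard ≤ t) :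
    (Set.range fun i => optFolios Φ N B T (P i)).encard ≤ classBound N b t := by
  refine le_trans (Set.encard_le_encard ?_) (encard_powerset_le
    (encard_powerset_le (encard_powerset_le (encard_featuresOver_le (N := N) hb ht))))
  rintro _ ⟨i, rfl⟩ _ ⟨Z, -, -, -, hlab, rfl⟩
  exact folio_subset hlab

/-- The labels in `T` that are connected to the boundary after the deletion of `Y`. -/
def boundaryLabels (Φ : Frame V L) (D B : Set V) (T : Set L) (Y : Set V) : Set L :=
  {l | ∃ y ∈ B, ∃ x ∈ D \ Y, LinkedIn Φ.G (B ∪ D \ Y) y x ∧ l ∈ Φ.lab x ∩ T}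

/-- After an admissible deletion, a connected set has fewer than `s` labels. -/
lemma Valid.encard_labels_lt (hΦ : Φ.Valid N m s) {D B : Set V} {T : Set L} {Y : Set V}
    (hadm : Φ.Adm D B T Y) {K : Set V} (hK : K ⊆ B ∪ D \ Y) (hconn : ConnIn Φ.G K) :
    {l | ∃ x ∈ K ∩ D, l ∈ Φ.lab x ∩ T}.encard < s := by
  by_contra! hcon
  obtain ⟨A, hA, hAs⟩ := Set.exists_subset_encard_eq hcon
  refine hadm _ (hΦ.single_mem A ?_ hAs) (Pattern.minorIn_single.2 ⟨K, hK, hconn, fun l hl => ?_⟩)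
  · intro h
    obtain ⟨x, -, hx⟩ := hA h
    exact hΦ.spare_notMem x hx.1
  · obtain ⟨x, hx, hl⟩ := hA hl
    exact ⟨x, hx.1, Or.inl ⟨hx.2, hl.1, hl.2⟩⟩

/-- Each boundary vertex lies in one component, which sees fewer than `s` labels of `T`. The bound
does not depend on the size of `T`, so the number of rounds can be fixed in advance. -/
lemma Valid.encard_boundaryLabels_le (hΦ : Φ.Valid N m s) {D B : Set V} {T : Set L} {Y : Set V}
    {b : ℕ} (hb : B.encard ≤ b) (hadm : Φ.Adm D B T Y) :
    (Φ.boundaryLabels D B T Y).encard ≤ (b * s : ℕ) := by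
  refine le_trans (Set.encard_le_encard ?_) (encard_biUnion_le_mul (J := B)
    (f := fun y => {l | ∃ x ∈ compIn Φ.G (B ∪ D \ Y) y ∩ D, l ∈ Φ.lab x ∩ T}) hb fun y hy => ?_)
  · rintro l ⟨y, hy, x, hx, hyx, hl⟩
    exact Set.mem_biUnion hy ⟨x, ⟨⟨Or.inr hx, hyx⟩, hx.1⟩, hl⟩
  · exact (hΦ.encard_labels_lt hadm (compIn_subset _ _) (connIn_compIn (Or.inl hy))).le

/-- Domination preserves admissibility, and does not create boundary labels. -/
lemma Valid.adm_of_dom (hΦ : Φ.Valid N m s) {D B : Set V} {T : Set L} {Y Z : Set V}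
    (hBD : Disjoint B D) (hadm : Φ.Adm D B T Y) (hdom : Φ.Dom D B T Y Z) :
    Φ.Adm D B Set.univ Z ∧
      ∀ x ∈ attached Φ.G B (D \ Z), Φ.lab x ⊆ Φ.boundaryLabels D B T Y := by
  have hadj : ∀ x ∈ D, ∀ y ∈ B, Φ.G.Adj x y → y ∈ B := fun _ _ _ hy _ => hy
  refine ⟨fun H hH hm => hadm H hH (hdom B subset_rfl hBD hadj _ H hH hm), ?_⟩
  rintro x ⟨hx, y, hy, hyx⟩ l hl
  have hls : l ≠ Φ.spare := fun h => hΦ.spare_notMem x (h ▸ hl)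
  -- Every boundary vertex receives the spare label. After domination, a connected set with both
  -- labels must contain a boundary vertex and a vertex of `D` carrying `l ∈ T`.
  have hm : (Pattern.single {Φ.spare, l}).MinorIn Φ.G
      (labelsOn Φ.lab D Set.univ fun _ => {Φ.spare}) (B ∪ D \ Z) := by
    refine Pattern.minorIn_single.2 ⟨compIn Φ.G (D \ Z ∪ B) y, ?_, connIn_compIn (Or.inr hy), ?_⟩
    · exact (compIn_subset _ _).trans (Set.union_comm _ _).subset
    · rintro _ (rfl | rfl)
      · exact ⟨y, mem_compIn_self (Or.inr hy),
          Or.inr ⟨Set.disjoint_left.1 hBD hy, rfl⟩⟩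
      · exact ⟨x, ⟨Or.inl hx, hyx⟩, Or.inl ⟨hx.1, hl, trivial⟩⟩
  obtain ⟨K, hK, hconn, hlab⟩ := Pattern.minorIn_single.1
    (hdom B subset_rfl hBD hadj _ _ (hΦ.pair_mem l hls) hm)
  obtain ⟨y', hy'K, hy'⟩ := hlab Φ.spare (Or.inl rfl)
  obtain ⟨x', hx'K, hx'⟩ := hlab l (Or.inr rfl)
  have hy'D : y' ∉ D := by
    rcases hy' with ⟨-, h, -⟩ | ⟨h, -⟩
    · exact absurd h (hΦ.spare_notMem y')
    · exact h
  have hx'D : x' ∈ D ∧ l ∈ Φ.lab x' ∩ T := by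
    rcases hx' with ⟨h1, h2, h3⟩ | ⟨-, h⟩
    · exact ⟨h1, h2, h3⟩
    · exact absurd h hls
  refine ⟨y', (hK hy'K).resolve_right fun h => hy'D h.1, x', ?_,
    (hconn.2 y' hy'K x' hx'K).mono hK, hx'D.2⟩
  exact (hK hx'K).resolve_left fun h => Set.disjoint_left.1 hBD h hx'D.1

section Union

variable {ι : Type*} {P : ι → Set V}

/-- The number of rounds in the choice of representative pieces. -/
def rounds (N m s b k : ℕ) : ℕ :=
  k + b * s + folioBound N b (b * s) * pieceBound N m b + 1

/-- A bound for the number of representative labels of a union of pieces. -/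
def unionBound (N m s b k g : ℕ) : ℕ := roundBound (classBound N b) g (rounds N m s b k)

/-- Each index with positive excess uses at least one unit of the total excess `k`. -/
lemma card_filter_lt_le {ι : Type*} [Fintype ι] {n o : ι → ℕ} {k : ℕ} (h : ∀ i, o i ≤ n i)
    (hk : ∑ i, n i ≤ ∑ i, o i + k) : {i | o i < n i}.encard ≤ k := by
  classical
  have h1 : {i | o i < n i} = ((Finset.univ.filter fun i => o i < n i : Finset ι) : Set ι) := by
    ext; simp
  rw [h1, Set.encard_coe_eq_coe_finsetCard]
  have h2 : (Finset.univ.filter fun i => o i < n i).card ≤ ∑ i, (n i - o i) := by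
    rw [Finset.card_eq_sum_ones]
    refine (Finset.sum_le_sum fun i hi => ?_).trans
      (Finset.sum_le_sum_of_subset (Finset.filter_subset _ _))
    have := (Finset.mem_filter.1 hi).2
    omega
  have h3 : ∑ i, (n i - o i) + ∑ i, o i = ∑ i, n i := by
    rw [← Finset.sum_add_distrib]
    exact Finset.sum_congr rfl fun i _ => Nat.sub_add_cancel (h i)
  exact_mod_cast h2.trans (by omega)

/-- Many rounds of representatives contain many with the same folio and no excess. -/
lemma exists_common_value {ι L C : Type*} {A : ℕ → Set L} (hA : Monotone A) {J : ℕ → Set ι}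
    (hJ : Monotone J) {j : ℕ → ι} {M : ℕ} (hj : ∀ r < M, j r ∈ J (r + 1) ∧ j r ∉ J r)
    {E : Set ι} {U : Set L} {k t q n : ℕ} (hE : E.encard ≤ k) (hU : U.encard ≤ t)
    (hM : k + t + q * n < M) {f : ι → C} {𝒞 : Set C} (h𝒞 : 𝒞.encard ≤ q)
    (hf : ∀ r < M, f (j r) ∈ 𝒞) :
    ∃ (S : Set ℕ) (y : C), (n : ℕ∞) < (j '' S).encard ∧ S.Nonempty ∧ ∀ r ∈ S, r < M ∧ j r ∉ E ∧
      U ∩ A (r + 1) ⊆ A r ∧ f (j r) = y := by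
  classical
  have hinj : Set.InjOn j (Set.Iio M) := by
    have key : ∀ r < M, ∀ r' < M, r < r' → j r ≠ j r' := by
      intro r hr r' hr' hlt h
      exact (hj r' hr').2 (h ▸ hJ (Nat.succ_le_of_lt hlt) (hj r hr).1)
    intro r hr r' hr' h
    by_contra hne
    rcases lt_or_gt_of_ne hne with hlt | hlt
    · exact key r hr r' hr' hlt h
    · exact key r' hr' r hr hlt h.symm
  have hbad₁ : ((Finset.range M).filter fun r => j r ∈ E).card ≤ k := by
    have : ((((Finset.range M).filter fun r => j r ∈ E : Finset ℕ)) : Set ℕ).encard ≤ k := by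
      refine (Set.encard_le_encard_of_injOn (t := E) (f := j) ?_ (hinj.mono ?_)).trans hE
      · intro r hr
        exact (Finset.mem_filter.1 hr).2
      · intro r hr
        exact Finset.mem_range.1 (Finset.mem_filter.1 hr).1
    rw [Set.encard_coe_eq_coe_finsetCard] at this
    exact_mod_cast this
  -- Each such round collects a label of `U` for the first time, and different rounds collect
  -- different labels.
  have hbad₂ : ((Finset.range M).filter fun r => ¬ U ∩ A (r + 1) ⊆ A r).card ≤ t := by
    have hex : ∀ r : ℕ, ¬ U ∩ A (r + 1) ⊆ A r → ∃ l ∈ U, l ∈ A (r + 1) ∧ l ∉ A r := by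
      intro r hr
      obtain ⟨l, hl, hl'⟩ := Set.not_subset.1 hr
      exact ⟨l, hl.1, hl.2, hl'⟩
    by_cases hne : ((Finset.range M).filter fun r => ¬ U ∩ A (r + 1) ⊆ A r) = ∅
    · simp [hne]
    obtain ⟨r₀, hr₀⟩ := Finset.nonempty_iff_ne_empty.2 hne
    obtain ⟨l₀, -⟩ := hex r₀ (Finset.mem_filter.1 hr₀).2
    have : Nonempty L := ⟨l₀⟩
    choose! e he₁ he₂ he₃ using hex
    have : ((((Finset.range M).filter fun r => ¬ U ∩ A (r + 1) ⊆ A r : Finset ℕ)) :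
        Set ℕ).encard ≤ t := by
      refine (Set.encard_le_encard_of_injOn (t := U) (f := e) ?_ ?_).trans hU
      · intro r hr
        exact he₁ r (Finset.mem_filter.1 hr).2
      · have key : ∀ r r', ¬ U ∩ A (r + 1) ⊆ A r → ¬ U ∩ A (r' + 1) ⊆ A r' → r < r' →
            e r ≠ e r' := by
          intro r r' hr hr' hlt h
          exact he₃ r' hr' (h ▸ hA (Nat.succ_le_of_lt hlt) (he₂ r hr))
        intro r hr r' hr' h
        have hr := (Finset.mem_filter.1 hr).2
        have hr' := (Finset.mem_filter.1 hr').2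
        by_contra hne
        rcases lt_or_gt_of_ne hne with hlt | hlt
        · exact key r r' hr hr' hlt h
        · exact key r' r hr' hr hlt h.symm
    rw [Set.encard_coe_eq_coe_finsetCard] at this
    exact_mod_cast this
  set good := (Finset.range M).filter fun r => j r ∉ E ∧ U ∩ A (r + 1) ⊆ A r with hgood
  have hcard : M ≤ good.card + (k + t) := by
    have hsub : Finset.range M ⊆ good ∪ (((Finset.range M).filter fun r => j r ∈ E) ∪
        (Finset.range M).filter fun r => ¬ U ∩ A (r + 1) ⊆ A r) := by
      intro r hr
      simp only [hgood, Finset.mem_union, Finset.mem_filter, hr, true_and]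
      tauto
    have h1 := Finset.card_le_card hsub
    rw [Finset.card_range] at h1
    have h2 := Finset.card_union_le good (((Finset.range M).filter fun r => j r ∈ E) ∪
        (Finset.range M).filter fun r => ¬ U ∩ A (r + 1) ⊆ A r)
    have h3 := Finset.card_union_le ((Finset.range M).filter fun r => j r ∈ E)
        ((Finset.range M).filter fun r => ¬ U ∩ A (r + 1) ⊆ A r)
    omega
  obtain ⟨h𝒞f, h𝒞n⟩ := Set.encard_le_coe_iff_finite_ncard_le.1 h𝒞
  lift 𝒞 to Finset C using h𝒞f
  rw [Set.ncard_coe_finset] at h𝒞n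
  obtain ⟨y, -, hy⟩ := Finset.exists_lt_card_fiber_of_mul_lt_card_of_maps_to (s := good)
    (t := 𝒞) (f := fun r => f (j r)) (n := n)
    (fun r hr => hf r (Finset.mem_range.1 (Finset.mem_filter.1 hr).1))
    (lt_of_le_of_lt (Nat.mul_le_mul_right n h𝒞n) (by omega))
  refine ⟨(good.filter fun r => f (j r) = y : Finset ℕ), y, ?_, ?_, ?_⟩
  · rw [Set.InjOn.encard_image, Set.encard_coe_eq_coe_finsetCard]
    · exact_mod_cast hy
    · refine hinj.mono fun r hr => ?_
      exact Finset.mem_range.1 (Finset.mem_filter.1 (Finset.mem_filter.1 hr).1).1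
  · exact Finset.coe_nonempty.2 (Finset.card_pos.1 (by omega))
  · intro r hr
    have h1 := Finset.mem_filter.1 hr
    have h2 := Finset.mem_filter.1 h1.1
    exact ⟨Finset.mem_range.1 h2.1, h2.2.1, h2.2.2, h1.2⟩

/-- Representative labels for a union of pieces. -/
lemma Valid.exists_good_iUnion [Finite V] [Finite ι] (hΦ : Φ.Valid N m s) {B : Set V} {b k g : ℕ}
    (hb : B.encard ≤ b) (hBP : ∀ i, Disjoint B (P i))
    (hadj : ∀ i j, i ≠ j → ∀ x ∈ P i, ∀ y ∈ P j, ¬ Φ.G.Adj x y)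
    (hdisj : ∀ i j, i ≠ j → Disjoint (P i) (P j))
    (hgood : ∀ i, ∃ T : Set L, T.encard ≤ g ∧ Φ.Good (P i) B k T) :
    ∃ T : Set L, T.encard ≤ unionBound N m s b k g ∧ Φ.Good (⋃ i, P i) B k T := by
  classical
  have := Fintype.ofFinite ι
  choose T hTg hT using hgood
  obtain ⟨A, J, hJ0, hJ, hA, hTA, hcls, hcard⟩ := exists_rounds
    (fun A i => optFolios Φ N B A (P i)) T g hTg (classBound N b)
    fun A t ht => encard_range_optFolios_le hb A t ht
  set M := rounds N m s b k with hM
  refine ⟨A M, hcard M, ?_⟩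
  intro Y hY hk hadm
  set D := ⋃ i, P i with hD
  have hPD : ∀ i, P i ⊆ D := Set.subset_iUnion P
  set U := Φ.boundaryLabels D B (A M) Y with hU
  have hdiff : ∀ i, P i \ (Y ∩ P i) = P i \ Y := fun i => by
    rw [Set.inter_comm, Set.sdiff_self_inter]
  have hadm_i : ∀ i, Φ.Adm (P i) B (A M) (Y ∩ P i) := by
    intro i H hH hm
    refine hadm H hH (hm.mono ?_ ?_)
    · rw [hdiff]
      exact Set.union_subset_union_right _ (Set.sdiff_subset_sdiff_left (hPD i))
    · rintro x - l (⟨h1, h2⟩ | ⟨-, h⟩)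
      · exact Or.inl ⟨hPD i h1, h2⟩
      · exact h.elim
  have hopt : ∀ i, Φ.opt (P i) ≤ (Y ∩ P i).ncard := fun i =>
    opt_le Set.inter_subset_right ((hΦ.free_of_adm (hadm_i i)).mono Set.subset_union_right)
  have hsum : ∑ i, (Y ∩ P i).ncard ≤ ∑ i, Φ.opt (P i) + k := by
    rw [← ncard_eq_sum hdisj hY]
    have : Φ.opt D ≤ ∑ i, Φ.opt (P i) := hΦ.opt_iUnion_le hadj
    omega
  -- No piece can fall below its optimum, so a single piece cannot exceed its own by more than the
  -- total excess.
  have hexc : ∀ i, (Y ∩ P i).ncard ≤ Φ.opt (P i) + k := by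
    intro i
    have h1 := Finset.add_sum_erase Finset.univ (fun i => (Y ∩ P i).ncard) (Finset.mem_univ i)
    have h2 := Finset.add_sum_erase Finset.univ (fun i => Φ.opt (P i)) (Finset.mem_univ i)
    have h3 := Finset.sum_le_sum fun j (_ : j ∈ Finset.univ.erase i) => hopt j
    omega
  have hround : ∀ M', ∀ j ∈ J M', ∃ r < M', j ∈ J (r + 1) ∧ j ∉ J r := by
    intro M'
    induction M' with
    | zero => intro j hj; simp [hJ0] at hj
    | succ r ih =>
      intro j hj
      by_cases hjr : j ∈ J r
      · obtain ⟨r', hr', h⟩ := ih j hjr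
        exact ⟨r', hr'.trans (Nat.lt_succ_self r), h⟩
      · exact ⟨r, Nat.lt_succ_self r, hj, hjr⟩
  have hTAM : ∀ j ∈ J M, T j ⊆ A M := by
    intro j hj
    obtain ⟨r, hr, h1, h2⟩ := hround M j hj
    exact (hTA r j h1 h2).trans (hA (Nat.succ_le_of_lt hr))
  have hZJ : ∀ j ∈ J M, ∃ Z ⊆ P j, Z.ncard ≤ (Y ∩ P j).ncard ∧
      Φ.Dom (P j) B (T j) (Y ∩ P j) Z := fun j hj =>
    hT j (Y ∩ P j) Set.inter_subset_right (hexc j) ((hadm_i j).mono (hTAM j hj))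
  choose! Z hZP hZc hZdom using hZJ
  have hZadm : ∀ j ∈ J M, Φ.Adm (P j) B Set.univ (Z j) ∧
      ∀ x ∈ attached Φ.G B (P j \ Z j), Φ.lab x ⊆ U ∩ T j := by
    intro j hj
    obtain ⟨h1, h2⟩ := hΦ.adm_of_dom (hBP j) ((hadm_i j).mono (hTAM j hj)) (hZdom j hj)
    refine ⟨h1, fun x hx l hl => ?_⟩
    obtain ⟨y, hy, x', hx', hyx, hl'⟩ := h2 x hx hl
    rw [hdiff] at hx' hyx
    have hs : P j \ Y ⊆ D \ Y := Set.sdiff_subset_sdiff_left (hPD j)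
    exact ⟨⟨y, hy, x', hs hx', hyx.mono (Set.union_subset_union_right _ hs), hl'.1,
      hTAM j hj hl'.2⟩, hl'.2⟩
  -- A piece that was never chosen has a classmate `j r` in every round `r < M`. Discarding at most
  -- `k` rounds with excess and `b * s` rounds that add boundary labels, the pigeonhole principle
  -- finds more than `pieceBound` classmates with one common folio; `rounds` adds up these numbers.
  have hN : ∀ i ∉ J M, ∃ Z' ⊆ P i, Z'.ncard ≤ (Y ∩ P i).ncard ∧ Φ.Adm (P i) B Set.univ Z' ∧
      ∃ J' ⊆ J M, (pieceBound N m b : ℕ∞) < J'.encard ∧ ∀ j ∈ J',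
        folio N Φ.G Φ.lab B (attached Φ.G B (P i \ Z')) =
          folio N Φ.G Φ.lab B (attached Φ.G B (P j \ Z j)) := by
    intro i hi
    have hex : ∀ r < M, ∃ j, j ∈ J (r + 1) ∧ j ∉ J r ∧
        optFolios Φ N B (A r) (P i) = optFolios Φ N B (A r) (P j) := by
      intro r hr
      obtain ⟨j, h1, h2, h3⟩ := hcls r i fun h => hi (hJ hr.le h)
      exact ⟨j, h1, h2, h3⟩
    have : Nonempty ι := ⟨i⟩
    choose! j hj1 hj2 hj3 using hex
    have hjM : ∀ r < M, j r ∈ J M := fun r hr => hJ (Nat.succ_le_of_lt hr) (hj1 r hr)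
    obtain ⟨S, y, hSn, ⟨r, hr⟩, hS⟩ := exists_common_value (q := folioBound N b (b * s))
      (n := pieceBound N m b)
      (f := fun j => folio N Φ.G Φ.lab B (attached Φ.G B (P j \ Z j)))
      (𝒞 := (featuresOver N B U).powerset.powerset) hA hJ
      (fun r hr => ⟨hj1 r hr, hj2 r hr⟩) (card_filter_lt_le hopt hsum)
      (hΦ.encard_boundaryLabels_le hb hadm) (M := M) (by rw [hM, rounds]; omega)
      (encard_powerset_le (encard_powerset_le (encard_featuresOver_le hb
        (hΦ.encard_boundaryLabels_le hb hadm))))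
      (fun r hr => folio_subset fun x hx => ((hZadm _ (hjM r hr)).2 x hx).trans
        Set.inter_subset_left)
    obtain ⟨hrM, hrE, hrU, hry⟩ := hS r hr
    -- In a round without new boundary labels, the attached labels of `P (j r)` lie already in `A
    -- r`, the set that defines the classes of that round. So the folio is visible in the class and
    -- also attained by an optimal set in `P i`.
    have hmem : y ∈ optFolios Φ N B (A r) (P (j r)) := by
      refine ⟨Z (j r), hZP _ (hjM r hrM), le_antisymm ?_ ?_, (hZadm _ (hjM r hrM)).1, ?_, hry.symm⟩
      · exact (hZc _ (hjM r hrM)).trans (not_lt.1 hrE)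
      · exact opt_le (hZP _ (hjM r hrM)) ((hΦ.free_of_adm (hZadm _ (hjM r hrM)).1).mono
          Set.subset_union_right)
      · intro x hx l hl
        have := (hZadm _ (hjM r hrM)).2 x hx hl
        exact hrU ⟨this.1, hTA r _ (hj1 r hrM) (hj2 r hrM) this.2⟩
    rw [← hj3 r hrM] at hmem
    obtain ⟨Z', h1, h2, h3, -, h5⟩ := hmem
    refine ⟨Z', h1, h2.trans_le (hopt i), h3, j '' S, ?_, hSn, ?_⟩
    · rintro _ ⟨r, hr, rfl⟩
      exact hjM r (hS r hr).1
    · rintro _ ⟨r, hr, rfl⟩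
      rw [← h5, ← (hS r hr).2.2.2]
  choose! Z' hZ'P hZ'c hZ'adm hZ'fol using hN
  set W : ι → Set V := fun i => if i ∈ J M then Z i else Z' i with hW
  have hWJ : ∀ i ∈ J M, W i = Z i := fun i hi => if_pos hi
  have hWN : ∀ i ∉ J M, W i = Z' i := fun i hi => if_neg hi
  have hWP : ∀ i, W i ⊆ P i ∧ (W i).ncard ≤ (Y ∩ P i).ncard := by
    intro i
    by_cases hi : i ∈ J M
    · rw [hWJ i hi]
      exact ⟨hZP i hi, hZc i hi⟩
    · rw [hWN i hi]
      exact ⟨hZ'P i hi, hZ'c i hi⟩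
  refine ⟨⋃ i, W i, Set.iUnion_mono fun i => (hWP i).1, ?_, ?_⟩
  · rw [ncard_eq_sum hdisj hY]
    exact (Set.ncard_iUnion_le_of_fintype _).trans (Finset.sum_le_sum fun i _ => (hWP i).2)
  · refine hΦ.dom_iUnion hb hadj hdisj (J := J M) ?_ ?_
    · intro j hj
      rw [hWJ j hj]
      exact (hZdom j hj).mono (hTAM j hj)
    · intro i hi
      rw [hWN i hi]
      refine ⟨hZ'adm i hi, ?_⟩
      obtain ⟨J', h1, h2, h3⟩ := hZ'fol i hi
      refine ⟨J', h1, h2, fun j hj => ?_⟩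
      rw [hWJ j (h1 hj)]
      exact h3 j hj

end Union

end Frame

/-! ### Scattered labels, the minor-free case and the induction on the elimination distance -/

namespace Frame

variable {V : Type z} {L : Type v} {Φ : Frame V L} {N m s : ℕ}

/-- Representative labels for a set are obtained from those for its components. -/
lemma Valid.exists_good_of_components [Finite V] (hΦ : Φ.Valid N m s) {D B : Set V} {b k g : ℕ}
    (hb : B.encard ≤ b) (hBD : Disjoint B D)
    (h : ∀ x ∈ D, ∃ T : Set L, T.encard ≤ g ∧ Φ.Good (compIn Φ.G D x) B k T) :
    ∃ T : Set L, T.encard ≤ unionBound N m s b k g ∧ Φ.Good D B k T := by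
  have hD : ⋃ i : {K : Set V // ∃ x ∈ D, K = compIn Φ.G D x}, i.1 = D := by
    ext y
    simp only [Set.mem_iUnion]
    constructor
    · rintro ⟨⟨_, x, hx, rfl⟩, hy⟩
      exact compIn_subset _ _ hy
    · exact fun hy => ⟨⟨_, y, hy, rfl⟩, mem_compIn_self hy⟩
  have hdisj : ∀ i j : {K : Set V // ∃ x ∈ D, K = compIn Φ.G D x}, i ≠ j →
      Disjoint i.1 j.1 := by
    rintro ⟨_, x, hx, rfl⟩ ⟨_, y, hy, rfl⟩ hij
    exact disjoint_compIn fun h => hij (Subtype.ext h)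
  rw [← hD]
  refine hΦ.exists_good_iUnion hb ?_ ?_ hdisj ?_
  · rintro ⟨_, x, hx, rfl⟩
    exact hBD.mono_right (compIn_subset _ _)
  · intro i j hij x hx y hy hxy
    refine Set.disjoint_left.1 (hdisj i j hij) ?_ hy
    obtain ⟨⟨_, a, ha, rfl⟩, ⟨_, c, hc, rfl⟩⟩ := i, j
    exact compIn_closed x hx y (compIn_subset _ _ hy) hxy
  · rintro ⟨_, x, hx, rfl⟩
    exact h x hx

/-- The labels in `T` that occur in `K`. -/
def labelsOf (Φ : Frame V L) (K : Set V) (T : Set L) : Set L := {l | ∃ x ∈ K, l ∈ Φ.lab x ∩ T}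

lemma labelsOf_mono {K K' : Set V} {T T' : Set L} (hK : K ⊆ K') (hT : T ⊆ T') :
    Φ.labelsOf K T ⊆ Φ.labelsOf K' T' := by
  rintro l ⟨x, hx, hl⟩
  exact ⟨x, hK hx, hl.1, hT hl.2⟩

/-- `Y` is a set of at most `k` vertices such that every connected subset of `D \ Y` has fewer
than `s` labels in `T`. -/
def Scatters (Φ : Frame V L) (s k : ℕ) (D : Set V) (T : Set L) (Y : Set V) : Prop :=
  Y ⊆ D ∧ Y.encard ≤ k ∧ ∀ K ⊆ D \ Y, ConnIn Φ.G K → (Φ.labelsOf K T).encard < s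

/-- A bound for the number of labels in `Scatters.exists_forced`. -/
def scatterBound (s k : ℕ) : ℕ := k * s + k * ((k + s) * s) + k + s

/-- If some set scatters the labels, the number of labels is bounded, or a vertex whose deletion
is forced by a bounded number of labels exists. -/
lemma Scatters.exists_forced {k : ℕ} {D : Set V} {T₀ : Set L} {Y : Set V}
    (hD : ConnIn Φ.G D) (h : Φ.Scatters s k D T₀ Y) :
    ∃ T ⊆ T₀, T.encard ≤ scatterBound s k ∧
      (Φ.labelsOf D T₀ ⊆ T ∨ ∃ p ∈ D, ∀ Y', Φ.Scatters s k D T Y' → p ∈ Y') := by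
  obtain ⟨hYD, hYk, hYs⟩ := h
  by_cases hbig : (Φ.labelsOf D T₀).encard ≤ scatterBound s k
  · exact ⟨_, by rintro l ⟨x, -, hl⟩; exact hl.2, hbig, Or.inl subset_rfl⟩
  by_cases hp : ∃ p ∈ Y, (s : ℕ∞) ≤ (Φ.labelsOf {p} T₀).encard
  · obtain ⟨p, hpY, hp⟩ := hp
    obtain ⟨A, hA, hAs⟩ := Set.exists_subset_encard_eq hp
    refine ⟨A, fun l hl => ?_, ?_, Or.inr ⟨p, hYD hpY, fun Y' hY' => ?_⟩⟩
    · obtain ⟨x, -, hl⟩ := hA hl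
      exact hl.2
    · rw [hAs]
      exact_mod_cast (by unfold scatterBound; omega : s ≤ scatterBound s k)
    · by_contra hpY'
      refine absurd (hY'.2.2 {p} ?_ (connIn_singleton p)) (not_lt.2 ?_)
      · rintro _ rfl
        exact ⟨hYD hpY, hpY'⟩
      · rw [← hAs]
        refine Set.encard_le_encard fun l hl => ?_
        obtain ⟨x, hx, hl'⟩ := hA hl
        exact ⟨x, hx, hl'.1, hl⟩
  push Not at hp
  set Λ : V → Set L := fun p =>
    {l | ∃ x ∈ D \ Y, (∃ q ∈ compIn Φ.G (D \ Y) x, Φ.G.Adj p q) ∧ l ∈ Φ.lab x ∩ T₀} with hΛ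
  -- As `D` is connected, each label outside `Y` lies in a component of `D \ Y` adjacent to some `p
  -- ∈ Y`. With few labels on `Y` itself, some `p` must see many through its adjacent components.
  obtain ⟨p, hpY, hpΛ⟩ : ∃ p ∈ Y, ¬ (Λ p).encard ≤ ((k + s) * s : ℕ) := by
    by_contra! hcon
    apply hbig
    rcases Set.eq_empty_or_nonempty Y with rfl | ⟨y₀, hy₀⟩
    · refine (hYs D (by simp) hD).le.trans ?_
      exact_mod_cast (by unfold scatterBound; omega : s ≤ scatterBound s k)
    · have hsub : Φ.labelsOf D T₀ ⊆ (⋃ p ∈ Y, Φ.labelsOf {p} T₀) ∪ ⋃ p ∈ Y, Λ p := by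
        rintro l ⟨x, hx, hl⟩
        by_cases hxY : x ∈ Y
        · exact Or.inl (Set.mem_biUnion hxY ⟨x, rfl, hl⟩)
        · obtain ⟨a, ha, c, hc, hxa, hac⟩ := (hD.2 x hx y₀ (hYD hy₀)).exists_first hxY hy₀
          exact Or.inr (Set.mem_biUnion hc.2 ⟨x, ⟨hx, hxY⟩, ⟨a, ⟨ha, hxa⟩, hac.symm⟩, hl⟩)
      refine (Set.encard_le_encard hsub).trans ((Set.encard_union_le _ _).trans ?_)
      refine (add_le_add (encard_biUnion_le_mul hYk fun p hp' => (hp p hp').le)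
        (encard_biUnion_le_mul hYk hcon)).trans ?_
      norm_cast
      unfold scatterBound
      omega
  obtain ⟨Lf, hLf, hLfc⟩ := Set.exists_subset_encard_eq (not_le.1 hpΛ).le
  have hex : ∀ l ∈ Λ p, ∃ x ∈ D \ Y, (∃ q ∈ compIn Φ.G (D \ Y) x, Φ.G.Adj p q) ∧
    l ∈ Φ.lab x ∩ T₀ := fun l hl => hl
  have : Nonempty V := ⟨p⟩
  choose! x hx hxp hxl using hex
  set K : L → Set V := fun l => compIn Φ.G (D \ Y) (x l) with hK
  have hKc : ∀ l ∈ Λ p, ConnIn Φ.G (K l) := fun l hl => connIn_compIn (hx l hl)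
  have hKs : ∀ l, K l ⊆ D \ Y := fun l => compIn_subset _ _
  have hxK : ∀ l ∈ Λ p, x l ∈ K l := fun l hl => mem_compIn_self (hx l hl)
  have hs : 0 < s := by
    obtain ⟨l, hl⟩ : (Λ p).Nonempty := by
      rw [← Set.encard_pos]
      exact pos_of_gt (not_le.1 hpΛ)
    have := hYs (K l) (hKs l) (hKc l hl)
    exact_mod_cast pos_of_gt this
  obtain ⟨A₀, hA₀, hbij⟩ := Set.exists_subset_bijOn Lf K
  -- Each component has fewer than `s` labels, so `(k + s) * s` labels meet at least `k + s`
  -- components.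
  have hA₀c : ((k + s : ℕ) : ℕ∞) ≤ A₀.encard := by
    by_contra! hlt
    obtain ⟨n, hn⟩ := ENat.ne_top_iff_exists.1 hlt.ne_top
    have hle : Lf.encard ≤ (n * s : ℕ) := by
      refine (Set.encard_le_encard ?_).trans (encard_biUnion_le_mul (J := A₀)
        (f := fun a => Φ.labelsOf (K a) T₀) hn.ge fun a ha =>
          (hYs (K a) (hKs a) (hKc a (hLf (hA₀ ha)))).le)
      intro l hl
      obtain ⟨a, ha, hal⟩ := hbij.surjOn ⟨l, hl, rfl⟩
      refine Set.mem_biUnion ha ⟨x l, ?_, hxl l (hLf hl)⟩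
      rw [hal]
      exact hxK l (hLf hl)
    rw [hLfc] at hle
    rw [← hn] at hlt
    have h1 : (k + s) * s ≤ n * s := by exact_mod_cast hle
    have h2 : n < k + s := by exact_mod_cast hlt
    exact absurd (Nat.le_of_mul_le_mul_right h1 hs) (by omega)
  obtain ⟨A, hA, hAc⟩ := Set.exists_subset_encard_eq hA₀c
  have hAΛ : A ⊆ Λ p := (hA.trans hA₀).trans hLf
  have hKinj : Set.InjOn K A := hbij.injOn.mono hA
  refine ⟨A, fun l hl => (hxl l (hAΛ hl)).2, ?_, Or.inr ⟨p, hYD hpY, fun Y' hY' => ?_⟩⟩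
  · rw [hAc]
    exact_mod_cast (by unfold scatterBound; omega : k + s ≤ scatterBound s k)
  by_contra hpY'
  -- A set `Y'` of at most `k` vertices that avoids `p` misses at least `s` of the `k + s` chosen
  -- components. Joined at `p`, these form a connected set with `s` chosen labels.
  set I := {l ∈ A | Disjoint (K l) Y'} with hI
  have hIc : (s : ℕ∞) ≤ I.encard := by
    have hout : (A \ I).encard ≤ k := by
      have hex : ∀ l ∈ A \ I, ∃ y ∈ Y', y ∈ K l := by
        rintro l ⟨hl, hlI⟩
        by_contra! hcon
        exact hlI ⟨hl, Set.disjoint_right.2 hcon⟩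
      choose! y hyY' hyK using hex
      refine (Set.encard_le_encard_of_injOn (t := Y') (f := y) hyY' ?_).trans hY'.2.1
      intro l hl l' hl' h
      by_contra hne
      refine Set.disjoint_left.1 (disjoint_compIn fun h => hne (hKinj hl.1 hl'.1 h))
        (hyK l hl) ?_
      rw [h]
      exact hyK l' hl'
    have hsum : (A \ I).encard + I.encard = A.encard :=
      Set.encard_sdiff_add_encard_of_subset fun l hl => hl.1
    rw [hAc] at hsum
    have hfin : I.encard ≠ ⊤ := fun h => by
      rw [h, add_top] at hsum
      exact ENat.natCast_ne_top _ hsum.symm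
    obtain ⟨n, hn⟩ := ENat.ne_top_iff_exists.1 hfin
    have hfin' : (A \ I).encard ≠ ⊤ := (lt_of_le_of_lt hout (ENat.natCast_lt_top k)).ne
    obtain ⟨n', hn'⟩ := ENat.ne_top_iff_exists.1 hfin'
    rw [← hn, ← hn'] at hsum
    rw [← hn'] at hout
    rw [← hn]
    norm_cast at hsum hout ⊢
    omega
  refine absurd (hY'.2.2 _ ?_ (ConnIn.union_star (p := p) (I := I) (K := K)
    (fun l hl => hKc l (hAΛ hl.1)) fun l hl => hxp l (hAΛ hl.1))) (not_lt.2 (hIc.trans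
      (Set.encard_le_encard fun l hl => ?_)))
  · rintro y (rfl | hy)
    · exact ⟨hYD hpY, hpY'⟩
    · simp only [Set.mem_iUnion] at hy
      obtain ⟨l, hl, hy⟩ := hy
      exact ⟨(hKs l hy).1, Set.disjoint_left.1 hl.2 hy⟩
  · exact ⟨x l, Or.inr (Set.mem_biUnion hl (hxK l (hAΛ hl.1))), (hxl l (hAΛ hl.1)).1, hl.1⟩

/-- For a connected set, a bounded number of labels contains all labels, or forces the deletion of
a vertex. -/
lemma exists_forced [Finite V] (s k : ℕ) {D : Set V} (hD : ConnIn Φ.G D) :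
    ∃ T : Set L, T.encard ≤ (scatterBound s k + 1 : ℕ) ∧
      (Φ.labelsOf D Set.univ ⊆ T ∨ ∃ p ∈ D, ∀ Y, Φ.Scatters s k D T Y → p ∈ Y) := by
  obtain ⟨p₀, hp₀⟩ := hD.1
  have hle : (scatterBound s k : ℕ∞) ≤ (scatterBound s k + 1 : ℕ) := by
    exact_mod_cast Nat.le_succ _
  by_cases hY : ∃ Y, Φ.Scatters s k D Set.univ Y
  · obtain ⟨Y, hY⟩ := hY
    obtain ⟨T, -, hT, h⟩ := hY.exists_forced hD
    exact ⟨T, hT.trans hle, h⟩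
  -- Labels are removed one by one until some `Y` scatters the rest. If then a bounded `T'` contains
  -- all remaining labels of `D`, adding back the last removed label makes scattering impossible,
  -- and any vertex is vacuously forced.
  have key : ∀ T : Set L, T.Finite → (∀ Y, ¬ Φ.Scatters s k D T Y) →
      ∃ T : Set L, T.encard ≤ (scatterBound s k + 1 : ℕ) ∧
        ∃ p ∈ D, ∀ Y, Φ.Scatters s k D T Y → p ∈ Y := by
    intro T hT
    induction T, hT using Set.Finite.induction_on with
    | empty => exact fun h => ⟨∅, by simp, p₀, hp₀, fun Y hY => absurd hY (h Y)⟩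
    | @insert l T _ _ ih =>
      intro h
      by_cases hY : ∃ Y, Φ.Scatters s k D T Y
      · obtain ⟨Y, hY⟩ := hY
        obtain ⟨T', hT', hT'c, h' | h'⟩ := hY.exists_forced hD
        · refine ⟨insert l T', ?_, p₀, hp₀, fun Y' hY' => absurd ?_ (h Y')⟩
          · refine (Set.encard_insert_le _ _).trans ?_
            push_cast
            gcongr
          · refine ⟨hY'.1, hY'.2.1, fun K hK hc =>
              lt_of_le_of_lt (Set.encard_le_encard ?_) (hY'.2.2 K hK hc)⟩
            rintro l' ⟨x, hx, hl', rfl | hlT⟩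
            · exact ⟨x, hx, hl', Or.inl rfl⟩
            · exact ⟨x, hx, hl', Or.inr (h' ⟨x, (hK hx).1, hl', hlT⟩)⟩
        · exact ⟨T', hT'c.trans hle, h'⟩
      · exact ih (not_exists.1 hY)
  -- There may be infinitely many labels, but only finitely many sets `Y`, and finitely many labels
  -- refute each of them.
  have hex : ∀ Y : Set V, ∃ A : Set L, A.Finite ∧ ¬ Φ.Scatters s k D A Y := by
    intro Y
    by_cases h : Y ⊆ D ∧ Y.encard ≤ k
    · have : ∃ K ⊆ D \ Y, ConnIn Φ.G K ∧ (s : ℕ∞) ≤ (Φ.labelsOf K Set.univ).encard := by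
        by_contra! hcon
        exact hY ⟨Y, h.1, h.2, hcon⟩
      obtain ⟨K, hK, hc, hs⟩ := this
      obtain ⟨A, hA, hAs⟩ := Set.exists_subset_encard_eq hs
      refine ⟨A, Set.finite_of_encard_eq_coe hAs, fun hsc => ?_⟩
      refine absurd (hsc.2.2 K hK hc) (not_lt.2 (hAs ▸ Set.encard_le_encard fun l hl => ?_))
      obtain ⟨x, hx, hl'⟩ := hA hl
      exact ⟨x, hx, hl'.1, hl⟩
    · exact ⟨∅, Set.finite_empty, fun hsc => h ⟨hsc.1, hsc.2.1⟩⟩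
  choose A hAf hA using hex
  obtain ⟨T, hT, h⟩ := key (⋃ Y, A Y) (Set.finite_iUnion hAf) fun Y hY =>
    hA Y ⟨hY.1, hY.2.1, fun K hK hc => lt_of_le_of_lt
      (Set.encard_le_encard (labelsOf_mono subset_rfl (Set.subset_iUnion A Y))) (hY.2.2 K hK hc)⟩
  exact ⟨T, hT, Or.inr h⟩

/-- Restricting to `T` loses nothing in `D`, so `Z = Y` works. -/
lemma good_of_labelsOf_subset {D B : Set V} {k : ℕ} {T : Set L}
    (h : Φ.labelsOf D Set.univ ⊆ T) : Φ.Good D B k T := by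
  refine fun Y hY _ _ => ⟨Y, hY, le_rfl, fun R _ _ _ mu H _ hm => hm.mono subset_rfl ?_⟩
  rintro x - l (⟨h1, h2, h3⟩ | h')
  · exact Or.inl ⟨h1, h2, h ⟨x, h1, h2, h3⟩⟩
  · exact Or.inr h'

lemma Valid.scatters_of_adm [Finite V] (hΦ : Φ.Valid N m s) {D B : Set V} {T : Set L} {Y : Set V}
    {k : ℕ} (hYD : Y ⊆ D) (hk : Y.ncard ≤ k) (hadm : Φ.Adm D B T Y) : Φ.Scatters s k D T Y := by
  refine ⟨hYD, ?_, fun K hK hc => ?_⟩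
  · rw [← Set.coe_ncard_eq_encard]
    exact_mod_cast hk
  · have := hΦ.encard_labels_lt hadm (hK.trans Set.subset_union_right) hc
    rwa [Set.inter_eq_left.2 (hK.trans Set.sdiff_subset)] at this

/-- A bound for the number of representative labels of an `F`-minor-free set. -/
def freeBound (N m s b : ℕ) : ℕ → ℕ
  | 0 => unionBound N m s b 0 (scatterBound s 0 + 1)
  | k + 1 => unionBound N m s b (k + 1) (scatterBound s (k + 1) + 1 + freeBound N m s b k)

/-- The optimum is 0, so admissible sets have at most `k` vertices and scatter the labels. In each
component either all labels are collected or some vertex lies in every admissible set; deleting it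
leaves a budget of `k - 1`, and for `k = 0` no vertex can be forced. -/
lemma Valid.exists_good_of_free [Finite V] (hΦ : Φ.Valid N m s) {B : Set V} {b : ℕ}
    (hb : B.encard ≤ b) (k : ℕ) {D : Set V} (hBD : Disjoint B D) (hD : Φ.Free D) :
    ∃ T : Set L, T.encard ≤ freeBound N m s b k ∧ Φ.Good D B k T := by
  induction k generalizing D with
  | zero =>
    refine hΦ.exists_good_of_components hb hBD fun x hx => ?_
    have hfree := hD.mono (compIn_subset (G := Φ.G) D x)
    obtain ⟨T, hT, h⟩ := exists_forced (Φ := Φ) s 0 (connIn_compIn (G := Φ.G) hx)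
    refine ⟨T, hT, ?_⟩
    rcases h with h | ⟨p, hp, h⟩
    · exact good_of_labelsOf_subset h
    · intro Y hY hk hadm
      rw [opt_eq_zero hfree] at hk
      have hpY := h Y (hΦ.scatters_of_adm hY (by omega) hadm)
      rw [(Set.ncard_eq_zero).1 (by omega : Y.ncard = 0)] at hpY
      exact hpY.elim
  | succ k ih =>
    refine hΦ.exists_good_of_components hb hBD fun x hx => ?_
    have hfree := hD.mono (compIn_subset (G := Φ.G) D x)
    have hdisj := hBD.mono_right (compIn_subset (G := Φ.G) D x)
    obtain ⟨T, hT, h⟩ := exists_forced (Φ := Φ) s (k + 1) (connIn_compIn (G := Φ.G) hx)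
    rcases h with h | ⟨p, hp, h⟩
    · refine ⟨T, hT.trans ?_, good_of_labelsOf_subset h⟩
      exact_mod_cast Nat.le_add_right _ _
    · obtain ⟨T', hT', hgood⟩ := ih (hdisj.mono_right Set.sdiff_subset)
        (hfree.mono (Set.sdiff_subset (t := {p})))
      refine ⟨T ∪ T', ?_, ?_⟩
      · refine (Set.encard_union_le _ _).trans ?_
        push_cast at hT ⊢
        gcongr
      · intro Y hY hk hadm
        rw [opt_eq_zero hfree] at hk
        have hpY := h Y (hΦ.scatters_of_adm hY (by omega) (hadm.mono Set.subset_union_left))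
        exact (hgood.mono Set.subset_union_right).exists_of_mem hp hY hpY (by omega) hadm

/-- The subgraph induced by `D` has elimination distance at most `d`. -/
def EdLe (Φ : Frame V L) : ℕ → Set V → Prop
  | 0, D => Φ.Free D
  | d + 1, D => ∀ A ⊆ D, ConnIn Φ.G A → Φ.Free A ∨ ∃ p ∈ A, EdLe Φ d (A \ {p})

/-- A bound for the number of representative labels in terms of the elimination distance, the size
of the boundary and the excess over the optimum. -/
def edBound (N m s : ℕ) : ℕ → ℕ → ℕ → ℕ
  | 0, b, k => freeBound N m s b k
  | d + 1, b, k => unionBound N m s b k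
      (freeBound N m s b k + (edBound N m s d b k + edBound N m s d (b + 1) (k + 1) + s))

/-- Sets of bounded elimination distance have a bounded number of representative labels. -/
theorem Valid.exists_good [Finite V] (hΦ : Φ.Valid N m s) (d : ℕ) {b k : ℕ} {D B : Set V}
    (hb : B.encard ≤ b) (hBD : Disjoint B D) (hD : Φ.EdLe d D) :
    ∃ T : Set L, T.encard ≤ edBound N m s d b k ∧ Φ.Good D B k T := by
  induction d generalizing b k D B with
  | zero => exact hΦ.exists_good_of_free hb k hBD hD
  | succ d ih =>
    refine hΦ.exists_good_of_components hb hBD fun x hx => ?_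
    have hsub := compIn_subset (G := Φ.G) D x
    have hdisj := hBD.mono_right hsub
    rcases hD _ hsub (connIn_compIn hx) with hfree | ⟨p, hp, hd⟩
    · obtain ⟨T, hT, h⟩ := hΦ.exists_good_of_free hb k hdisj hfree
      exact ⟨T, hT.trans (by exact_mod_cast Nat.le_add_right _ _), h⟩
    · have hdisj' := hdisj.mono_right (Set.sdiff_subset (t := {p}))
      obtain ⟨T₁, hT₁, h₁⟩ := ih (k := k) hb hdisj' hd
      obtain ⟨T₂, hT₂, h₂⟩ := ih (b := b + 1) (k := k + 1) (B := insert p B)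
        ((Set.encard_insert_le _ _).trans (by push_cast; gcongr))
        (Set.disjoint_insert_left.2 ⟨fun h => h.2 rfl, hdisj'⟩) hd
      -- Even if `p` has many labels, `s` of them suffice: they already force `p` into every
      -- admissible set.
      obtain ⟨T₃, hT₃, h₃⟩ : ∃ T₃ : Set L, T₃.encard ≤ s ∧
          (Φ.lab p ⊆ T₃ ∨ ∃ A ⊆ Φ.lab p ∩ T₃, A.encard = s) := by
        rcases le_total (Φ.lab p).encard s with h | h
        · exact ⟨Φ.lab p, h, Or.inl subset_rfl⟩
        · obtain ⟨A, hA, hAs⟩ := Set.exists_subset_encard_eq h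
          exact ⟨A, hAs.le, Or.inr ⟨A, Set.subset_inter hA subset_rfl, hAs⟩⟩
      refine ⟨T₁ ∪ T₂ ∪ T₃, ?_, hΦ.good_of_vertex hp h₁ h₂ h₃⟩
      refine ((Set.encard_union_le _ _).trans (add_le_add ((Set.encard_union_le _ _).trans
        (add_le_add hT₁ hT₂)) hT₃)).trans ?_
      exact_mod_cast Nat.le_add_left _ _

end Frame

/-! ### Translating minor models of graphs into patterns -/

section Transport

variable {V : Type z} {L : Type v} {G : SimpleGraph V}

lemma connIn_induce {S : Set V} {A : Set S} :
    ConnIn (G.induce S) A ↔ ConnIn G (Subtype.val '' A) := by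
  constructor
  · rintro ⟨hne, h⟩
    refine ⟨hne.image _, ?_⟩
    rintro _ ⟨x, hx, rfl⟩ _ ⟨y, hy, rfl⟩
    exact Relation.ReflTransGen.lift (p := fun x y => G.Adj x y ∧ x ∈ Subtype.val '' A ∧
      y ∈ Subtype.val '' A) (fun x : S => (x : V))
      (fun a b h => ⟨h.1, ⟨a, h.2.1, rfl⟩, ⟨b, h.2.2, rfl⟩⟩) _ _ (h x hx y hy)
  · rintro ⟨hne, h⟩
    refine ⟨hne.of_image, fun x hx y hy => ?_⟩
    have key : ∀ t, LinkedIn G (Subtype.val '' A) x t → ∃ ht : t ∈ S,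
        LinkedIn (G.induce S) A x ⟨t, ht⟩ := by
      intro t ht
      induction ht with
      | refl => exact ⟨x.2, LinkedIn.refl _ _⟩
      | @tail b c _ hbc ih =>
        obtain ⟨hb, ih⟩ := ih
        obtain ⟨hadj, ⟨b', hb', rfl⟩, ⟨c', hc', rfl⟩⟩ := hbc
        exact ⟨c'.2, ih.trans (.of_adj hadj hb' hc')⟩
    exact (key y (h x ⟨x, hx, rfl⟩ y ⟨y, hy, rfl⟩)).2

/-- The pattern on `Fin n` that is isomorphic to a given finite labeled graph. -/
noncomputable def patternOf {W : Type*} [Finite W] (G' : SimpleGraph W) (lab' : W → Set L) :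
    Pattern L :=
  ⟨Nat.card W, G'.comap (Finite.equivFin W).symm, fun a => lab' ((Finite.equivFin W).symm a)⟩

lemma connected_patternOf {W : Type*} [Finite W] {G' : SimpleGraph W} (lab' : W → Set L)
    (h : G'.Connected) : (patternOf G' lab').graph.Connected :=
  (SimpleGraph.Iso.comap (Finite.equivFin W).symm G').connected_iff.2 h

lemma minorIn_patternOf {W : Type*} [Finite W] {G' : SimpleGraph W} {lab' : W → Set L}
    {lab : V → Set L} {S : Set V} : (patternOf G' lab').MinorIn G lab S ↔
      ∃ φ : W → Set V, (∀ a, φ a ⊆ S) ∧ (∀ a, ConnIn G (φ a)) ∧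
        (∀ a b, a ≠ b → Disjoint (φ a) (φ b)) ∧
        (∀ a b, G'.Adj a b → ∃ x ∈ φ a, ∃ y ∈ φ b, G.Adj x y) ∧
        ∀ a, ∀ l ∈ lab' a, ∃ x ∈ φ a, l ∈ lab x := by
  set e := Finite.equivFin W with he
  constructor
  · rintro ⟨φ, h1, h2, h3, h4, h5⟩
    refine ⟨fun a => φ (e a), fun a => h1 _, fun a => h2 _,
      fun a b hab => h3 _ _ fun h => hab (e.injective h), fun a b hab => h4 _ _ ?_,
      fun a l hl => h5 _ l ?_⟩
    · change G'.Adj (e.symm (e a)) (e.symm (e b))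
      simpa using hab
    · change l ∈ lab' (e.symm (e a))
      simpa using hl
  · rintro ⟨φ, h1, h2, h3, h4, h5⟩
    exact ⟨fun a => φ (e.symm a), fun a => h1 _, fun a => h2 _,
      fun a b hab => h3 _ _ fun h => hab (e.symm.injective h), fun a b hab => h4 _ _ hab,
      fun a l hl => h5 _ l hl⟩

/-- Minor models in an induced subgraph, in terms of subsets of the host. -/
lemma exists_model_induce_iff (H : FinGraph.{u}) (G : FinGraph.{z}) (S : Set G.V)
    (lab' : H.V → Set L) (lab : G.V → Set L) :
    (∃ φ : H.V → Set S, IsMinorModel H (G.induce S) φ ∧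
      ∀ a, ∀ l ∈ lab' a, ∃ x ∈ φ a, l ∈ lab x) ↔
      (patternOf H.graph lab').MinorIn G.graph lab S := by
  rw [minorIn_patternOf]
  constructor
  · rintro ⟨φ, hφ, hl⟩
    refine ⟨fun a => Subtype.val '' φ a, ?_, fun a => ?_, fun a b hab => ?_, fun a b hab => ?_,
      fun a l hla => ?_⟩
    · rintro a _ ⟨x, -, rfl⟩
      exact x.2
    · exact connIn_induce.1 ((connIn_iff _).1 (hφ.connected a))
    · exact (Set.disjoint_image_iff Subtype.val_injective).2 (hφ.disjoint a b hab)
    · obtain ⟨x, hx, y, hy, hxy⟩ := hφ.adj a b hab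
      exact ⟨x.1, ⟨x, hx, rfl⟩, y.1, ⟨y, hy, rfl⟩, hxy⟩
    · obtain ⟨x, hx, hlx⟩ := hl a l hla
      exact ⟨x.1, ⟨x, hx, rfl⟩, hlx⟩
  · rintro ⟨φ, h1, h2, h3, h4, h5⟩
    have himg : ∀ a, Subtype.val '' (Subtype.val ⁻¹' φ a : Set S) = φ a := fun a => by
      rw [Subtype.image_preimage_coe, Set.inter_eq_right.2 (h1 a)]
    refine ⟨fun a => Subtype.val ⁻¹' φ a, ⟨fun a => ?_, fun a b hab => ?_, fun a b hab => ?_⟩,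
      fun a l hla => ?_⟩
    · refine (connIn_iff (V := S) (G := G.graph.induce S) _).2 (connIn_induce.2 ?_)
      rw [himg]
      exact h2 a
    · exact (h3 a b hab).preimage _
    · obtain ⟨x, hx, y, hy, hxy⟩ := h4 a b hab
      exact ⟨⟨x, h1 a hx⟩, hx, ⟨y, h1 b hy⟩, hy, hxy⟩
    · obtain ⟨x, hx, hlx⟩ := h5 a l hla
      exact ⟨⟨x, h1 a hx⟩, hx, hlx⟩

/-- The pattern of an unlabeled graph. -/
noncomputable def plainPattern (L : Type v) (H : FinGraph.{u}) : Pattern L :=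
  patternOf H.graph fun _ => ∅

/-- The pattern of an `X`-labeled graph, with labels in `Option X`. -/
noncomputable def labeledPattern {X : Type v} (H : LabeledGraph.{v, w} X) : Pattern (Option X) :=
  patternOf H.graph fun a => some '' H.lab a

lemma isMinor_induce_iff (H : FinGraph.{u}) (G : FinGraph.{z}) (S : Set G.V)
    (lab : G.V → Set L) :
    IsMinor H (G.induce S) ↔ (plainPattern L H).MinorIn G.graph lab S := by
  unfold plainPattern
  rw [← exists_model_induce_iff]
  exact exists_congr fun φ => ⟨fun h => ⟨h, fun _ _ hl => hl.elim⟩, fun h => h.1⟩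

lemma isLabeledMinor_delete_iff {X : Type v} (H : LabeledGraph.{v, w} X)
    (C : LabeledGraph.{v, z} X) (Y : Set C.V) :
    IsLabeledMinor H (C.delete Y) ↔
      (labeledPattern H).MinorIn C.graph (fun x => some '' C.lab x) Yᶜ := by
  unfold labeledPattern
  rw [← exists_model_induce_iff]
  refine exists_congr fun φ => and_congr_right fun _ => forall_congr' fun a => ?_
  constructor
  · rintro h _ ⟨l, hl, rfl⟩
    obtain ⟨x, hx, hlx⟩ := h l hl
    exact ⟨x, hx, l, hlx, rfl⟩
  · intro h l hl
    obtain ⟨x, hx, l', hlx, hll⟩ := h (some l) ⟨l, hl, rfl⟩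
    exact ⟨x, hx, Option.some_injective X hll ▸ hlx⟩

end Transport

/-! ### From elimination forests to the recursive bound `EdLe` -/

section EliminationDistance

namespace Frame

variable {V : Type z} {L : Type v} {Φ : Frame V L} {N m s : ℕ}

lemma EdLe.mono {d : ℕ} {D D' : Set V} (h : Φ.EdLe d D') (hD : D ⊆ D') : Φ.EdLe d D := by
  cases d with
  | zero => exact Free.mono h hD
  | succ d => exact fun A hA => h A (hA.trans hD)

lemma Free.edLe {D : Set V} (h : Φ.Free D) (d : ℕ) : Φ.EdLe d D := by
  cases d with
  | zero => exact h
  | succ d => exact fun A hA _ => Or.inl (h.mono hA)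

lemma Valid.edLe_iUnion (hΦ : Φ.Valid N m s) {ι : Type*} {I : Set ι} {P : ι → Set V}
    (hadj : ∀ i ∈ I, ∀ j ∈ I, i ≠ j → ∀ x ∈ P i, ∀ y ∈ P j, ¬ Φ.G.Adj x y) {d : ℕ}
    (h : ∀ i ∈ I, Φ.EdLe d (P i)) : Φ.EdLe d (⋃ i ∈ I, P i) := by
  cases d with
  | zero => exact hΦ.free_iUnion hadj h
  | succ d =>
    intro A hA hc
    obtain ⟨x, hx⟩ := hc.1
    obtain ⟨i, hi, hxi⟩ := Set.mem_iUnion₂.1 (hA hx)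
    refine h i hi A (hc.subset_of_closed hA (fun a ha b hb hab => ?_) ⟨x, hx, hxi⟩) hc
    obtain ⟨j, hj, hbj⟩ := Set.mem_iUnion₂.1 hb
    by_cases hij : i = j
    · exact hij ▸ hbj
    · exact absurd hab (hadj i hi j hj hij a ha b hbj)

/-- The bags of the nodes above a node of a rooted tree have elimination distance at most the
height of the node. -/
lemma Valid.edLe_of_tree (hΦ : Φ.Valid N m s) {T : RootedTree.{0}} [Finite T] {bag : T → Set V}
    (hint : ∀ t, ¬ IsMax t → ∃ p, bag t = {p})
    (hedge : ∀ r t, ∀ x ∈ bag r, ∀ y ∈ bag t, Φ.G.Adj x y → r ≤ t ∨ t ≤ r)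
    (hleaf : ∀ t, IsMax t → Φ.Free (bag t)) (d : ℕ) (t : T)
    (hd : ∀ r, t ≤ r → (Set.Iio r).ncard ≤ (Set.Iio t).ncard + d) :
    Φ.EdLe d (⋃ r ∈ Set.Ici t, bag r) := by
  have hlt : ∀ r t : T, r < t → (Set.Iio r).ncard + 1 ≤ (Set.Iio t).ncard := by
    intro r t hrt
    rw [← Set.ncard_insert_of_notMem (show r ∉ Set.Iio r from lt_irrefl r)]
    refine Set.ncard_le_ncard ?_
    rintro q (rfl | hq)
    · exact hrt
    · exact hq.trans hrt
  have hmax : ∀ t, IsMax t → ⋃ r ∈ Set.Ici t, bag r = bag t := by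
    intro t ht
    rw [show Set.Ici t = {t} from Set.eq_singleton_iff_unique_mem.2
      ⟨le_rfl, fun r hr => (ht.eq_of_le hr).symm⟩]
    simp
  induction d generalizing t with
  | zero =>
    have ht : IsMax t := by
      rw [isMax_iff_forall_not_lt]
      intro r hr
      have := hlt t r hr
      have := hd r hr.le
      omega
    rw [hmax t ht]
    exact hleaf t ht
  | succ d ih =>
    by_cases ht : IsMax t
    · rw [hmax t ht]
      exact (hleaf t ht).edLe _
    obtain ⟨p, hp⟩ := hint t ht
    -- Nodes below different children are incomparable, so no edges join their bags and the subtrees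
    -- combine at no extra depth.
    have hrest : Φ.EdLe d (⋃ c ∈ {c | t ⋖ c}, ⋃ r ∈ Set.Ici c, bag r) := by
      refine hΦ.edLe_iUnion ?_ fun c hc => ih c fun r hr => ?_
      · intro c hc c' hc' hne x hx y hy hxy
        obtain ⟨r, hr, hx⟩ := Set.mem_iUnion₂.1 hx
        obtain ⟨r', hr', hy⟩ := Set.mem_iUnion₂.1 hy
        have hcc : c ≤ c' ∨ c' ≤ c := by
          rcases hedge r r' x hx y hy hxy with h | h
          · exact le_total_of_directed hr' (le_trans hr h)
          · exact le_total_of_directed (le_trans hr' h) hr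
        rcases hcc with h | h
        · exact hc'.2 hc.1 (lt_of_le_of_ne h hne)
        · exact hc.2 hc'.1 (lt_of_le_of_ne h hne.symm)
      · have := hlt t c hc.1
        have := hd r (hc.1.le.trans hr)
        omega
    have hcov : ∀ x ∈ ⋃ r ∈ Set.Ici t, bag r, x = p ∨
        x ∈ ⋃ c ∈ {c | t ⋖ c}, ⋃ r ∈ Set.Ici c, bag r := by
      intro x hx
      obtain ⟨r, hr, hx⟩ := Set.mem_iUnion₂.1 hx
      rcases eq_or_lt_of_le (show t ≤ r from hr) with rfl | hr
      · rw [hp] at hx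
        exact Or.inl hx
      · obtain ⟨c, hc, hcr⟩ := exists_covBy_le_of_lt hr
        exact Or.inr (Set.mem_biUnion hc (Set.mem_biUnion hcr hx))
    intro A hA hc
    right
    by_cases hpA : p ∈ A
    · exact ⟨p, hpA, hrest.mono fun x hx => (hcov x (hA hx.1)).resolve_left hx.2⟩
    -- Here `A` already lies in the subtrees of the children, and deleting an arbitrary vertex does
    -- no harm.
    · obtain ⟨q, hq⟩ := hc.1
      exact ⟨q, hq, hrest.mono fun x hx => (hcov x (hA hx.1)).resolve_left
        fun h => hpA (h ▸ hx.1)⟩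

end Frame

/-- A path that eliminates the vertices one by one; its additional last node is a leaf with empty
bag. Existence ensures that the infimum in `elimDist` is attained and not the default value 0. -/
lemma nonempty_elimTree (F : Set FinGraph.{u}) (hF : ∀ H ∈ F, H.graph.Connected)
    (G : FinGraph.{z}) : Nonempty (ElimTree F G) := by
  classical
  set n := Nat.card G.V
  set e : G.V ≃ Fin n := Finite.equivFin G.V
  set bag : Fin (n + 1) → Set G.V := fun i => {x | (e x).1 = i.1} with hbag
  have hbagmax : ∀ t : Fin (n + 1), IsMax t → bag t = ∅ := by
    intro t ht
    have ht' : t = Fin.last n := ht.eq_of_le (Fin.le_last t)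
    ext x
    simp only [hbag, Set.mem_ofPred_eq, ht', Fin.val_last, Set.mem_empty_iff_false, iff_false]
    exact (e x).2.ne
  exact ⟨{
    T := ⟨Fin (n + 1)⟩
    finite := inferInstanceAs (Finite (Fin (n + 1)))
    bag := bag
    cover := by
      rw [Set.eq_univ_iff_forall]
      exact fun x => Set.mem_iUnion.2 ⟨(e x).castSucc, rfl⟩
    disjoint := by
      intro r t hrt
      rw [Set.disjoint_left]
      intro x hx hx'
      exact hrt (Fin.ext (hx.symm.trans hx'))
    internal := by
      intro t ht
      have ht' : t.1 < n := by
        by_contra h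
        refine ht fun r _ => ?_
        have h1 := r.2
        exact Fin.le_def.2 (by omega)
      have : bag t = {e.symm ⟨t.1, ht'⟩} := by
        ext x
        rw [Set.mem_singleton_iff, Equiv.eq_symm_apply, Fin.ext_iff]
        rfl
      rw [this, Set.ncard_singleton]
    edge := by
      intro a b hab
      right
      refine ⟨(e a).castSucc, (e b).castSucc, rfl, rfl, ?_⟩
      refine lt_or_gt_of_ne fun h => hab.ne (e.injective ?_)
      exact Fin.castSucc_injective n h
    leaf := by
      intro t ht
      rw [hbagmax t ht]
      refine ⟨fun a => a.2.elim, ?_⟩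
      rintro H hH ⟨φ, hφ⟩
      obtain ⟨a⟩ := (hF H hH).nonempty
      obtain ⟨x⟩ := (hφ.connected a).nonempty
      exact x.1.2 }⟩

end EliminationDistance

section EliminationDistance

lemma Pattern.MinorIn.induce {V : Type z} {L : Type v} {G : SimpleGraph V} {H : Pattern L}
    {lab : V → Set L} {S : Set V} {A : Set S} (h : H.MinorIn G lab (Subtype.val '' A)) :
    H.MinorIn (G.induce S) (fun x => lab x) A := by
  obtain ⟨φ, h1, h2, h3, h4, h5⟩ := h
  have hS : ∀ a, ∀ x ∈ φ a, ∃ hx : x ∈ S, (⟨x, hx⟩ : S) ∈ A := by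
    intro a x hx
    obtain ⟨y, hy, rfl⟩ := h1 a hx
    exact ⟨y.2, hy⟩
  refine ⟨fun a => Subtype.val ⁻¹' φ a, fun a x hx => (hS a x hx).2, fun a => ?_,
    fun a b hab => (h3 a b hab).preimage _, fun a b hab => ?_, fun a l hl => ?_⟩
  · rw [connIn_induce, Subtype.image_preimage_coe,
      Set.inter_eq_right.2 fun x hx => (hS a x hx).1]
    exact h2 a
  · obtain ⟨x, hx, y, hy, hxy⟩ := h4 a b hab
    exact ⟨⟨x, (hS a x hx).1⟩, hx, ⟨y, (hS b y hy).1⟩, hy, hxy⟩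
  · obtain ⟨x, hx, hlx⟩ := h5 a l hl
    exact ⟨⟨x, (hS a x hx).1⟩, hx, hlx⟩

/-- The elimination distance bounds `EdLe`. -/
lemma Frame.Valid.edLe_elimDist {F : Set FinGraph.{u}} (hF : ∀ H ∈ F, H.graph.Connected)
    {C : FinGraph.{z}} {L : Type v} {Φ : Frame C.V L} {N m s : ℕ} (hΦ : Φ.Valid N m s)
    (hG : Φ.G = C.graph) (hΦF : Φ.F = plainPattern L '' F) :
    Φ.EdLe (elimDist F C) Set.univ := by
  have hne : (Set.range fun E : ElimForest F C => E.depth).Nonempty :=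
    ⟨_, fun c => (nonempty_elimTree F hF (C.induce c.supp)).some, rfl⟩
  obtain ⟨E, hE⟩ := Nat.sInf_mem hne
  change E.depth = elimDist F C at hE
  have hcomp : ∀ c : C.graph.ConnectedComponent, Φ.EdLe (elimDist F C) c.supp := by
    intro c
    have : Finite (E c).T := (E c).finite
    have hdepth : ∀ t : (E c).T, (Set.Iio t).ncard ≤ elimDist F C := by
      intro t
      have h1 : (Set.Iio t).ncard ≤ (E c).depth :=
        le_ciSup (f := fun t : (E c).T => (Set.Iio t).ncard) (Set.finite_range _).bddAbove t
      have h2 : (E c).depth ≤ E.depth :=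
        le_ciSup (f := fun c => (E c).depth) (Set.finite_range _).bddAbove c
      omega
    have huniq : ∀ x : c.supp, ∀ r t : (E c).T, x ∈ (E c).bag r → x ∈ (E c).bag t → r = t := by
      intro x r t hr ht
      by_contra hne
      exact Set.disjoint_left.1 ((E c).disjoint r t hne) hr ht
    refine (hΦ.edLe_of_tree (T := (E c).T) (bag := fun t => Subtype.val '' (E c).bag t) ?_ ?_ ?_
      (elimDist F C) ⊥ fun r _ => (hdepth r).trans (Nat.le_add_left _ _)).mono ?_
    · intro t ht
      obtain ⟨p, hp⟩ := Set.ncard_eq_one.1 ((E c).internal t ht)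
      exact ⟨p.1, (congrArg (Set.image Subtype.val) hp).trans Set.image_singleton⟩
    · rintro r t _ ⟨x, hx, rfl⟩ _ ⟨y, hy, rfl⟩ hxy
      rw [hG] at hxy
      rcases (E c).edge x y hxy with ⟨q, -, hxq, hyq⟩ | ⟨q, q', hxq, hyq, h⟩
      · rw [huniq x r q hx hxq, huniq y t q hy hyq]
        exact Or.inl le_rfl
      · rw [huniq x r q hx hxq, huniq y t q' hy hyq]
        exact h.imp le_of_lt le_of_lt
    · intro t ht H hH hm
      rw [hΦF] at hH
      obtain ⟨H, hH, rfl⟩ := hH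
      rw [hG] at hm
      refine ((E c).leaf t ht).2 H hH
        ((isMinor_induce_iff (L := L) H (C.induce c.supp) _ fun _ => ∅).2 hm.induce)
    · intro x hx
      have hx' : (⟨x, hx⟩ : c.supp) ∈ ⋃ t, (E c).bag t := by
        rw [(E c).cover]
        trivial
      obtain ⟨t, ht⟩ := Set.mem_iUnion.1 hx'
      exact Set.mem_biUnion (bot_le : ⊥ ≤ t) ⟨_, ht, rfl⟩
  refine (hΦ.edLe_iUnion (I := Set.univ)
    (P := fun c : C.graph.ConnectedComponent => c.supp) ?_ fun c _ => hcomp c).mono ?_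
  · intro c _ c' _ hne x hx y hy hxy
    rw [hG] at hxy
    refine hne ?_
    rw [← (SimpleGraph.ConnectedComponent.mem_supp_iff _ _).1 hx,
      ← (SimpleGraph.ConnectedComponent.mem_supp_iff _ _).1 hy]
    exact SimpleGraph.ConnectedComponent.sound hxy.reachable
  · intro x _
    exact Set.mem_biUnion (Set.mem_univ (C.graph.connectedComponentMk x)) rfl

end EliminationDistance

/-! ### The frame of an instance and the exchange argument -/

section Host

variable {X : Type v}

/-- The frame of an instance of the main lemma. -/
noncomputable def hostFrame (F : Set FinGraph.{u}) (Q : Set (LabeledGraph.{v, w} X))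
    (C : LabeledGraph.{v, z} X) (s : ℕ) : Frame C.V (Option X) where
  G := C.graph
  lab := fun x => some '' C.lab x
  F := plainPattern (Option X) '' F
  fam := plainPattern (Option X) '' F ∪
    -- Members of `Q` with more labels need no control: a model of one puts `s` labels into a
    -- connected set, which the single-vertex patterns exclude. This bounds the number of labels per
    -- pattern.
    labeledPattern '' {H | H ∈ Q ∧ (⋃ a, H.lab a).encard ≤ s} ∪
    Pattern.single '' {A | none ∉ A ∧ A.encard = s} ∪
    (fun l => Pattern.single {none, l}) '' {l | l ≠ none}
  spare := none

lemma encard_labPairs_single_le {L : Type v} (A : Set L) :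
    (Pattern.single A).labPairs.encard ≤ A.encard := by
  refine Set.encard_le_encard_of_injOn (f := Prod.snd) (fun p hp => hp) ?_
  rintro ⟨a, l⟩ - ⟨b, l'⟩ - rfl
  rw [Subsingleton.elim (α := Fin 1) a b]

/-- In `N * s + s + 2` the summands cover the members of `Q` with at most `s` labels, the saturating
single vertices, and the pairs with the spare label. -/
lemma hostFrame_valid {F : Set FinGraph.{u}} (hF : ∀ H ∈ F, H.graph.Connected)
    {Q : Set (LabeledGraph.{v, w} X)} (hQ : ∀ H ∈ Q, H.graph.Connected)
    (C : LabeledGraph.{v, z} X) {N s : ℕ} (hN : 1 ≤ N) (hFN : ∀ H ∈ F, Nat.card H.V ≤ N)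
    (hQN : ∀ H ∈ Q, Nat.card H.V ≤ N) : (hostFrame F Q C s).Valid N (N * s + s + 2) s where
  F_subset := fun H hH => Or.inl (Or.inl (Or.inl hH))
  connected := by
    rintro _ (((⟨H, hH, rfl⟩ | ⟨H, hH, rfl⟩) | ⟨A, -, rfl⟩) | ⟨l, -, rfl⟩)
    · exact connected_patternOf _ (hF H hH)
    · exact connected_patternOf _ (hQ H hH.1)
    · exact Pattern.connected_single _
    · exact Pattern.connected_single _
  card_le := by
    rintro _ (((⟨H, hH, rfl⟩ | ⟨H, hH, rfl⟩) | ⟨A, -, rfl⟩) | ⟨l, -, rfl⟩)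
    · exact hFN H hH
    · exact hQN H hH.1
    · exact hN
    · exact hN
  labPairs_le := by
    rintro _ (((⟨H, hH, rfl⟩ | ⟨H, hH, rfl⟩) | ⟨A, ⟨-, hA⟩, rfl⟩) | ⟨l, -, rfl⟩)
    · have : (plainPattern (Option X) H).labPairs = ∅ :=
        Set.eq_empty_of_forall_notMem fun p hp => hp
      simp [this]
    · have hsub : (labeledPattern H).labPairs ⊆
          (Set.univ : Set (Fin (Nat.card H.V))) ×ˢ (some '' ⋃ a, H.lab a) := by
        rintro ⟨a, l⟩ ⟨x, hx, rfl⟩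
        exact ⟨trivial, x, Set.mem_iUnion.2 ⟨_, hx⟩, rfl⟩
      have hcard : ((Set.univ : Set (Fin (Nat.card H.V))) ×ˢ
          (some '' ⋃ a, H.lab a)).encard ≤ ((N * s + s + 2 : ℕ) : ℕ∞) := by
        rw [Set.encard_prod, Set.encard_univ, ENat.card_eq_coe_fintype_card, Fintype.card_fin]
        have h1 : ((Nat.card H.V : ℕ) : ℕ∞) ≤ N := by exact_mod_cast hQN H hH.1
        have h2 := (Set.encard_image_le some (⋃ a, H.lab a)).trans hH.2
        refine (mul_le_mul' h1 h2).trans ?_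
        exact_mod_cast (by omega : N * s ≤ N * s + s + 2)
      exact (Set.encard_le_encard hsub).trans hcard
    · refine (encard_labPairs_single_le A).trans ?_
      rw [hA]
      exact_mod_cast (by omega : s ≤ N * s + s + 2)
    · refine (encard_labPairs_single_le _).trans ((Set.encard_insert_le _ _).trans ?_)
      rw [Set.encard_singleton]
      exact_mod_cast (by omega : 1 + 1 ≤ N * s + s + 2)
  unlabeled := by
    rintro _ ⟨H, -, rfl⟩ a
    rfl
  single_mem := fun A h1 h2 => Or.inl (Or.inr ⟨A, ⟨h1, h2⟩, rfl⟩)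
  pair_mem := fun l hl => Or.inr ⟨l, hl, rfl⟩
  spare_notMem := by
    rintro x ⟨l, -, hl⟩
    exact Option.some_ne_none l hl

lemma minorIn_labeledPattern_of_single {V : Type z} {G : SimpleGraph V} {lab : V → Set (Option X)}
    {S : Set V} {H : LabeledGraph.{v, w} X} (hH : Nat.card H.V = 1) {A : Set (Option X)}
    (hA : ∀ a, some '' H.lab a = A) (h : (Pattern.single A).MinorIn G lab S) :
    (labeledPattern H).MinorIn G lab S := by
  obtain ⟨K, h1, h2, h3⟩ := Pattern.minorIn_single.1 h
  have : Subsingleton H.V := (Nat.card_eq_one_iff_unique.1 hH).1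
  refine minorIn_patternOf.2 ⟨fun _ => K, fun _ => h1, fun _ => h2,
    fun a b hab => absurd (Subsingleton.elim a b) hab,
    fun a b hab => absurd (Subsingleton.elim a b) hab.ne, fun a l hl => h3 l (hA a ▸ hl)⟩

/-- A bounded number of labels preserves all labeled minors that are unavoidable for optimal
solutions. -/
lemma exists_labels {F : Set FinGraph.{u}} (hF : ∀ H ∈ F, H.graph.Connected)
    {Q : Set (LabeledGraph.{v, w} X)} (hQ : ∀ H ∈ Q, H.graph.Connected)
    {C : LabeledGraph.{v, z} X} {N s : ℕ} (hN : 1 ≤ N) (hFN : ∀ H ∈ F, Nat.card H.V ≤ N)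
    (hQN : ∀ H ∈ Q, Nat.card H.V ≤ N) (hsat : IsSaturated s Q)
    (hC : ∀ Y : Set C.V, IsOptimalSolution F C.toFinGraph Y → HasLabeledMinor Q (C.delete Y)) :
    ∃ T : Set (Option X),
      T.encard ≤ Frame.edBound N (N * s + s + 2) s (elimDist F C.toFinGraph) 0 0 ∧
      ∀ Y : Set C.V, IsOptimalSolution F C.toFinGraph Y →
        ∃ H ∈ Q, (∀ a, some '' H.lab a ⊆ T) ∧ IsLabeledMinor H (C.delete Y) := by
  set Φ := hostFrame F Q C s with hΦdef
  have hΦ := hostFrame_valid hF hQ C hN hFN hQN (s := s)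
  rw [← hΦdef] at hΦ
  -- The whole graph has no boundary, and only optimal solutions matter, so the excess is 0.
  obtain ⟨T, hT, hgood⟩ := hΦ.exists_good (elimDist F C.toFinGraph) (b := 0) (k := 0) (B := ∅)
    (D := Set.univ) (by simp) (by simp) (hΦ.edLe_elimDist hF rfl rfl)
  refine ⟨T, hT, fun Y hY => ?_⟩
  by_contra! hcon
  have hhost : ∀ Y : Set C.V, (∅ : Set C.V) ∪ Set.univ \ Y = Yᶜ := fun Y => by
    rw [Set.empty_union, Set.compl_eq_univ_sdiff]
  have hlab : ∀ T x, labelsOn Φ.lab Set.univ T (fun _ => ∅) x = some '' C.lab x ∩ T := fun T x =>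
    labelsOn_of_mem (Set.mem_univ x)
  have hfull : ∀ {H : Pattern (Option X)} {T : Set (Option X)} {S : Set C.V},
      H.MinorIn C.graph (labelsOn Φ.lab Set.univ T fun _ => ∅) S →
      H.MinorIn C.graph (fun x => some '' C.lab x) S := fun h =>
    h.mono subset_rfl fun x _ => by
      rw [hlab]
      exact Set.inter_subset_left
  have hfull' : ∀ {H : Pattern (Option X)} {S : Set C.V},
      H.MinorIn C.graph (fun x => some '' C.lab x) S →
      H.MinorIn C.graph (labelsOn Φ.lab Set.univ Set.univ fun _ => ∅) S := fun h =>
    h.mono subset_rfl fun x _ => by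
      rw [hlab]
      exact Set.subset_inter subset_rfl (Set.subset_univ _)
  have hsol : ∀ Y : Set C.V, IsSolution F C.toFinGraph Y ↔ Φ.Free (Set.univ \ Y) := by
    intro Y
    rw [← Set.compl_eq_univ_sdiff]
    constructor
    · rintro h _ ⟨H, hH, rfl⟩ hm
      exact h H hH ((isMinor_induce_iff H C.toFinGraph _ _).2 hm)
    · exact fun h H hH hm => h _ ⟨H, hH, rfl⟩ ((isMinor_induce_iff H C.toFinGraph _ _).1 hm)
  have hlabT : ∀ H ∈ Q, ¬ (labeledPattern H).MinorIn C.graph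
      (labelsOn Φ.lab Set.univ T fun _ => ∅) Yᶜ := by
    intro H hH hm
    refine hcon H hH ?_ ((isLabeledMinor_delete_iff H C Y).2 (hfull hm))
    obtain ⟨φ, -, -, -, -, h5⟩ := minorIn_patternOf.1 hm
    intro a l hl
    obtain ⟨x, -, hx⟩ := h5 a l hl
    rw [hlab] at hx
    exact hx.2
  -- Each kind of controlled pattern is excluded: forbidden minors since `Y` is a solution, members
  -- of `Q` by the choice of `Y`, single vertices with `s` labels since saturation puts them into
  -- `Q`, and pairs since the host never carries the spare label.
  have hadm : Φ.Adm Set.univ ∅ T Y := by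
    intro H hH hm
    rw [hhost] at hm
    rcases hH with ((⟨H, hH, rfl⟩ | ⟨H, hH, rfl⟩) | ⟨A, ⟨hAn, hA⟩, rfl⟩) | ⟨l, hl, rfl⟩
    · exact hY.1 H hH ((isMinor_induce_iff H C.toFinGraph _ _).2 hm)
    · exact hlabT H hH.1 hm
    · have himg : some '' (some ⁻¹' A) = A := by
        rw [Set.image_preimage_eq_iff]
        intro l hl
        cases l with
        | none => exact absurd hl hAn
        | some x => exact ⟨x, rfl⟩
      obtain ⟨H, hH, hcard, hHA⟩ := hsat (some ⁻¹' A) (by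
        rw [← (Option.some_injective X).encard_image, himg, hA])
      exact hlabT H hH (minorIn_labeledPattern_of_single hcard
        (fun a => by rw [hHA, himg]) hm)
    · obtain ⟨K, -, -, h⟩ := Pattern.minorIn_single.1 hm
      obtain ⟨x, -, hx⟩ := h none (Or.inl rfl)
      rw [hlab] at hx
      obtain ⟨⟨y, -, hy⟩, -⟩ := hx
      exact Option.some_ne_none y hy
  have hYopt : Y.ncard ≤ Φ.opt Set.univ + 0 := by
    obtain ⟨Y', -, h2, h3⟩ := hΦ.exists_opt Set.univ
    have := hY.2 Y' ((hsol Y').2 h2)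
    omega
  obtain ⟨Z, -, hZc, hdom⟩ := hgood Y (Set.subset_univ _) hYopt hadm
  have hdom' : ∀ H ∈ Φ.fam, ¬ H.MinorIn C.graph (fun x => some '' C.lab x) Zᶜ := by
    intro H hH hm
    refine hadm H hH (hdom ∅ subset_rfl (by simp) (fun _ _ _ h _ => h) _ H hH ?_)
    rw [hhost]
    exact hfull' hm
  have hZopt : IsOptimalSolution F C.toFinGraph Z := by
    refine ⟨fun H hH hm => ?_, fun Y' hY' => hZc.trans (hY.2 Y' hY')⟩
    exact hdom' _ (hΦ.F_subset ⟨H, hH, rfl⟩) ((isMinor_induce_iff H C.toFinGraph _ _).1 hm)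
  obtain ⟨H, hH, hm⟩ := hC Z hZopt
  rw [isLabeledMinor_delete_iff] at hm
  by_cases hs : (⋃ a, H.lab a).encard ≤ s
  · exact hdom' _ (Or.inl (Or.inl (Or.inr ⟨H, ⟨hH, hs⟩, rfl⟩))) hm
  · obtain ⟨A, hA, hAs⟩ := Set.exists_subset_encard_eq (not_le.1 hs).le
    refine hdom' (Pattern.single (some '' A)) (hΦ.single_mem _ ?_ ?_) ?_
    · rintro ⟨y, -, hy⟩
      exact Option.some_ne_none y hy
    · rw [(Option.some_injective X).encard_image, hAs]
    · obtain ⟨φ, h1, h2, h3, h4, h5⟩ := hm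
      have hconn := connected_patternOf (fun a => some '' H.lab a) (hQ H hH)
      obtain ⟨a₀⟩ := hconn.nonempty
      obtain ⟨x₀, hx₀⟩ := (h2 a₀).1
      refine Pattern.minorIn_single.2 ⟨compIn C.graph Zᶜ x₀, compIn_subset _ _,
        connIn_compIn (h1 a₀ hx₀), ?_⟩
      rintro _ ⟨l, hl, rfl⟩
      obtain ⟨a, ha⟩ := Set.mem_iUnion.1 (hA hl)
      obtain ⟨x, hx, hlx⟩ := h5 (Finite.equivFin H.V a) (some l) (by
        change some l ∈ some '' H.lab ((Finite.equivFin H.V).symm (Finite.equivFin H.V a))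
        rw [Equiv.symm_apply_apply]
        exact ⟨l, ha, rfl⟩)
      exact ⟨x, Pattern.MinorIn.of_connected hconn h1 h2 h4 compIn_closed
        ⟨x₀, hx₀, mem_compIn_self (h1 a₀ hx₀)⟩ _ hx, hlx⟩

end Host

/-! ### Counting patterns over a bounded label set and the conclusion -/

section Counting

/-- The number of patterns with at most `N` vertices and labels from a set of size `t`. -/
noncomputable def patternBound (N t : ℕ) : ℕ :=
  Nat.card (Σ n : Fin (N + 1), SimpleGraph (Fin n) × (Fin n → Set (Fin t)))

/-- Labels are pulled back along a map from `Fin t` whose range covers `T`, so the count depends on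
`N` and `t` only. -/
lemma encard_patterns_le {L : Type v} [Nonempty L] (N t : ℕ) {T : Set L} (hT : T.encard ≤ t) :
    {H : Pattern L | H.n ≤ N ∧ ∀ a, H.lab a ⊆ T}.encard ≤ patternBound N t := by
  obtain ⟨hTf, hTc⟩ := Set.encard_le_coe_iff_finite_ncard_le.1 hT
  obtain ⟨e, he⟩ : ∃ e : Fin t → L, T ⊆ Set.range e := by
    have := hTf.fintype
    obtain ⟨g⟩ : Nonempty (T ↪ Fin t) := Function.Embedding.nonempty_of_card_le (by
      rw [Fintype.card_fin, ← Nat.card_eq_fintype_card]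
      exact hTc)
    refine ⟨Function.extend g Subtype.val fun _ => Classical.arbitrary L, fun l hl =>
      ⟨g ⟨l, hl⟩, g.injective.extend_apply _ _ _⟩⟩
  refine (Set.encard_le_encard ?_).trans (encard_range_le_natCard
    (fun p : Σ n : Fin (N + 1), SimpleGraph (Fin n) × (Fin n → Set (Fin t)) =>
      (⟨p.1, p.2.1, fun a => e '' p.2.2 a⟩ : Pattern L)) le_rfl)
  rintro ⟨n, G, lab⟩ ⟨hn, hlab⟩
  refine ⟨⟨⟨n, Nat.lt_succ_of_le hn⟩, G, fun a => e ⁻¹' lab a⟩, ?_⟩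
  have : (fun a => e '' (e ⁻¹' lab a)) = lab := funext fun a =>
    Set.image_preimage_eq_iff.2 ((hlab a).trans he)
  simp only [this]

end Counting

end MinorDeletion

open MinorDeletion

theorem mainTheorem6 (F : Set FinGraph.{u}) (hFfin : F.Finite) (hFne : F.Nonempty)
    (hFconn : ∀ H ∈ F, H.graph.Connected) :
    ∃ f : ℕ → ℕ, ∀ (X : Type v) (Q : Set (LabeledGraph.{v, w} X)) (C : LabeledGraph.{v, z} X),
      (∀ H ∈ Q, H.graph.Connected) →
      (∀ H ∈ Q, Nat.card H.V ≤ maxEdges F + 1) →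
      IsSaturated (minVerts F) Q →
      (∀ Y : Set C.V, IsOptimalSolution F C.toFinGraph Y → HasLabeledMinor Q (C.delete Y)) →
      ∃ Qs ⊆ Q, Qs.encard ≤ f (elimDist F C.toFinGraph) ∧
        ∀ Y : Set C.V, IsOptimalSolution F C.toFinGraph Y → HasLabeledMinor Qs (C.delete Y) := by
  obtain ⟨N₀, hN₀⟩ := (hFfin.image fun H => Nat.card H.V).bddAbove
  set N := N₀ + (maxEdges F + 1) with hN
  set s := minVerts F
  refine ⟨fun d => patternBound N (Frame.edBound N (N * s + s + 2) s d 0 0), ?_⟩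
  intro X Q C hQconn hQcard hsat hC
  have hQN : ∀ H ∈ Q, Nat.card H.V ≤ N := fun H hH => (hQcard H hH).trans (by omega)
  obtain ⟨T, hT, hmain⟩ := exists_labels hFconn hQconn (N := N) (by omega)
    (fun H hH => (hN₀ ⟨H, hH, rfl⟩).trans (by omega)) hQN hsat hC
  -- One member of `Q` is kept per pattern over `T`; being a labeled minor depends only on the
  -- pattern.
  obtain ⟨Qs, hQs, hbij⟩ := Set.exists_subset_bijOn {H | H ∈ Q ∧ ∀ a, some '' H.lab a ⊆ T}
    labeledPattern
  refine ⟨Qs, fun H hH => (hQs hH).1, ?_, fun Y hY => ?_⟩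
  · rw [← hbij.injOn.encard_image]
    refine (Set.encard_le_encard ?_).trans (encard_patterns_le N _ hT)
    rintro _ ⟨H, hH, rfl⟩
    exact ⟨hQN H (hQs hH).1, fun a => (hQs hH).2 _⟩
  · obtain ⟨H, hH, hHT, hm⟩ := hmain Y hY
    obtain ⟨H', hH', hHH'⟩ := hbij.surjOn ⟨H, ⟨hH, hHT⟩, rfl⟩
    refine ⟨H', hH', ?_⟩
    rw [isLabeledMinor_delete_iff] at hm ⊢
    rwa [hHH']
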